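/- Let $n\ge 1$ and let $P_n=(\mathfrak S_n,\preceq)$ be the symmetric group on $[n]=\{1,\dots,n\}$ with the absolute order: $u\preceq v$ if and only if $\ell(u)+\ell(u^{-1}v)=\ell(v)$, where $\ell(w)$ is the least $m$ such that $w$ is a product of $m$ transpositions. The rank of a finite poset is one less than the largest cardinality of a chain in it. A finite poset $P$ of rank $d$ with a minimum element is called *strongly constructible* (a recursive definition) if either $P$ has a maximum element and its order complex is pure shellable, or $P=I_1\cup I_2$ for two strongly constructible proper order ideals $I_1,I_2$ of $P$, both of rank $d$, such that $I_1\cap I_2$ is strongly constructible of rank at least $d-1$. Here a $d$-dimensional simplicial complex is pure if all its facets have dimension $d$, and it is pure shellable if moreover its facets can be totally ordered as $G_1,\dots,G_m$ so that for all $1<i\le m$ the intersection of the complex generated by $G_1,\dots,G_{i-1}$ with the simplex $G_i$ is pure of dimension $d-1$. Let $k\ge 0$, let $\tau_0,\tau_1,\dots,\tau_k$ be pairwise disjoint subsets of $[n]$ with $\tau_1,\dots,\tau_k$ nonempty ($\tau_0$ may be empty), and let $\sigma$ be a nonempty sequence of distinct elements of $[n]$, none of which belongs to any $\tau_i$. Put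 $R=(\sigma,\tau_0,\dots,\tau_k)$, and let $\mathcal S_n(R)$ be the set of permutations $w\in\mathfrak S_n$ that have exactly $k+1$ cycles (fixed points counted as cycles) and whose cycles can be labelled $c_0,c_1,\dots,c_k$ such that the elements of $\sigma$ appear consecutively in $c_0$, in the order in which they appear in $\sigma$, and all elements of $\tau_i$ appear in $c_i$ for $0\le i\le k$. Then the order ideal of $P_n$ generated by $\mathcal S_n(R)$ is strongly constructible. In particular, $P_n$ itself is strongly constructible. -/

import Mathlib

/-! ### Finite simplicial complexes and order complexes -/

/-- The facets of a simplicial complex (given as the set of its faces): its maximal faces. -/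
def complexFacets {α : Type*} (Δ : Set (Finset α)) : Set (Finset α) :=
  {F | Maximal (fun G => G ∈ Δ) F}

/-- `Δ` has dimension `d`: a face `F` has dimension `|F| - 1`, and `d` is the largest dimension of
a face (the complex whose only face is empty has dimension `-1`). -/
def HasDimension {α : Type*} (Δ : Set (Finset α)) (d : ℤ) : Prop :=
  (∃ F ∈ Δ, (F.card : ℤ) - 1 = d) ∧ ∀ F ∈ Δ, (F.card : ℤ) - 1 ≤ d

/-- `Δ` is pure of dimension `d`: it has dimension `d`, and so has each of its facets. -/
def IsPureOfDimension {α : Type*} (Δ : Set (Finset α)) (d : ℤ) : Prop :=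
  HasDimension Δ d ∧ ∀ F ∈ complexFacets Δ, (F.card : ℤ) - 1 = d

/-- `Δ` is pure of some dimension `d`, and there is a total ordering `G 0, G 1, …` of its (finitely
many) facets such that for each `i > 0` the intersection of the complex generated by the
`G j`, `j < i`, with the simplex `G i` is pure of dimension `d - 1`. -/
def IsPureShellable {α : Type*} (Δ : Set (Finset α)) : Prop :=
  ∃ d : ℤ, IsPureOfDimension Δ d ∧
    ∃ (m : ℕ) (G : Fin m → Finset α), Function.Injective G ∧ Set.range G = complexFacets Δ ∧
      ∀ i : Fin m, 0 < i.val →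
        IsPureOfDimension {F : Finset α | (∃ j : Fin m, j < i ∧ F ⊆ G j) ∧ F ⊆ G i} (d - 1)

/-- The order complex of the subposet `s` of `P`: its faces are the finite chains in `s`. -/
def orderComplex {P : Type*} [PartialOrder P] (s : Set P) : Set (Finset P) :=
  {F | (F : Set P) ⊆ s ∧ IsChain (· ≤ ·) (F : Set P)}

/-- The subposet `s` has rank `d`: its order complex has dimension `d`. -/
def HasRank {P : Type*} [PartialOrder P] (s : Set P) (d : ℤ) : Prop :=
  HasDimension (orderComplex s) d

/-- `I` is an order ideal of the subposet `s`. -/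
def IsOrderIdealOf {P : Type*} [PartialOrder P] (I s : Set P) : Prop :=
  I ⊆ s ∧ ∀ x ∈ s, ∀ y ∈ I, x ≤ y → x ∈ I

/-- The subposet `s` of `P` (with the induced order) is strongly constructible. A poset `P` is
strongly constructible if this holds for `s = Set.univ`. -/
inductive IsStronglyConstructible {P : Type*} [PartialOrder P] : Set P → Prop
  /-- A finite poset that is bounded and pure shellable. -/
  | bounded (s : Set P) (hfin : s.Finite) (hmin : ∃ a, IsLeast s a) (hmax : ∃ b, IsGreatest s b)
      (hshell : IsPureShellable (orderComplex s)) : IsStronglyConstructible s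
  /-- A finite poset of rank `d` with a minimum element that is the union of two strongly
  constructible proper ideals of rank `d`, whose intersection is strongly constructible of rank
  at least `d - 1`. -/
  | union (s I₁ I₂ : Set P) (d e : ℤ) (hfin : s.Finite) (hmin : ∃ a, IsLeast s a)
      (hrank : HasRank s d) (hs : s = I₁ ∪ I₂)
      (hI₁ : IsOrderIdealOf I₁ s) (hI₂ : IsOrderIdealOf I₂ s)
      (hne₁ : I₁ ≠ s) (hne₂ : I₂ ≠ s)
      (hrank₁ : HasRank I₁ d) (hrank₂ : HasRank I₂ d)
      (hrank₁₂ : HasRank (I₁ ∩ I₂) e) (hde : d - 1 ≤ e)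
      (h₁ : IsStronglyConstructible I₁) (h₂ : IsStronglyConstructible I₂)
      (h₁₂ : IsStronglyConstructible (I₁ ∩ I₂)) : IsStronglyConstructible s

/-! ### The absolute order on the symmetric group -/

/-- The reflection length of a permutation: the smallest `k` such that `w` is a product of `k`
transpositions. -/
noncomputable def reflectionLength {n : ℕ} (w : Equiv.Perm (Fin n)) : ℕ :=
  sInf {k | ∃ l : List (Equiv.Perm (Fin n)), (∀ t ∈ l, t.IsSwap) ∧ l.prod = w ∧ l.length = k}

theorem reflectionLength_spec {n : ℕ} (w : Equiv.Perm (Fin n)) :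
    ∃ l : List (Equiv.Perm (Fin n)), (∀ t ∈ l, t.IsSwap) ∧ l.prod = w ∧
      l.length = reflectionLength w := by
  obtain ⟨l, h1, h2⟩ := (Equiv.Perm.truncSwapFactors w).out
  exact Nat.sInf_mem (s := {k | ∃ l : List (Equiv.Perm (Fin n)),
    (∀ t ∈ l, t.IsSwap) ∧ l.prod = w ∧ l.length = k}) ⟨_, l, h2, h1, rfl⟩

theorem reflectionLength_le {n : ℕ} (l : List (Equiv.Perm (Fin n))) (hl : ∀ t ∈ l, t.IsSwap) :
    reflectionLength l.prod ≤ l.length :=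
  Nat.sInf_le ⟨l, hl, rfl, rfl⟩

theorem reflectionLength_one {n : ℕ} : reflectionLength (1 : Equiv.Perm (Fin n)) = 0 := by
  simpa using reflectionLength_le ([] : List (Equiv.Perm (Fin n))) (by simp)

theorem eq_one_of_reflectionLength {n : ℕ} {w : Equiv.Perm (Fin n)}
    (h : reflectionLength w = 0) : w = 1 := by
  obtain ⟨l, -, h2, h3⟩ := reflectionLength_spec w
  rw [h, List.length_eq_zero_iff] at h3
  simpa [h3] using h2.symm

theorem reflectionLength_mul_le {n : ℕ} (u v : Equiv.Perm (Fin n)) :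
    reflectionLength (u * v) ≤ reflectionLength u + reflectionLength v := by
  obtain ⟨l, h1, h2, h3⟩ := reflectionLength_spec u
  obtain ⟨m, k1, k2, k3⟩ := reflectionLength_spec v
  have := reflectionLength_le (l ++ m) (by
    intro t ht
    rcases List.mem_append.1 ht with h | h
    · exact h1 t h
    · exact k1 t h)
  rw [List.prod_append, h2, k2, List.length_append, h3, k3] at this
  exact this

/-- The absolute order on the symmetric group: `u ≤ v` if and only if
`ℓ(u) + ℓ(u⁻¹ v) = ℓ(v)`. With this order, `Equiv.Perm (Fin n)` is the poset `P_n`. -/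
instance absoluteOrder (n : ℕ) : PartialOrder (Equiv.Perm (Fin n)) where
  le u v := reflectionLength u + reflectionLength (u⁻¹ * v) = reflectionLength v
  le_refl u := by simp [reflectionLength_one]
  le_trans u v w huv hvw := by
    have h1 := reflectionLength_mul_le (u⁻¹ * v) (v⁻¹ * w)
    have h2 := reflectionLength_mul_le u (u⁻¹ * w)
    rw [show u⁻¹ * v * (v⁻¹ * w) = u⁻¹ * w by group] at h1
    rw [show u * (u⁻¹ * w) = w by group] at h2
    change _ = _ at huv hvw ⊢
    omega
  le_antisymm u v huv hvu := by
    change _ = _ at huv hvu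
    have h : u⁻¹ * v = 1 := eq_one_of_reflectionLength (by omega)
    exact inv_mul_eq_one.1 h

/-! ### The sets of permutations `S_n(R)` -/

/-- The data `R = (σ, τ 0, …, τ k)`: pairwise disjoint subsets `τ i` of the ground set, nonempty
for `i ≠ 0`, and a nonempty sequence `σ` of distinct elements belonging to none of them. -/
structure CycleDatum (n k : ℕ) where
  σ : List (Fin n)
  τ : Fin (k + 1) → Finset (Fin n)
  σ_ne_nil : σ ≠ []
  σ_nodup : σ.Nodup
  τ_disjoint : ∀ i j, i ≠ j → Disjoint (τ i) (τ j)
  τ_nonempty : ∀ i, i ≠ 0 → (τ i).Nonempty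
  σ_notMem_τ : ∀ x ∈ σ, ∀ i, x ∉ τ i

/-- `S_n(R)`: the permutations `w` whose cycles (fixed points count as cycles of length one) can be
numbered bijectively as `c 0, …, c k` in such a way that the elements of `σ` lie in `c 0` and `w`
maps each element of `σ` but the last to the next one, and the elements of `τ i` lie in `c i`.
The cycles of `w` are represented by the classes of the relation "lie in the same cycle of `w`". -/
def CycleDatum.perms {n k : ℕ} (R : CycleDatum n k) : Set (Equiv.Perm (Fin n)) :=
  {w | ∃ c : Fin (k + 1) ≃ Quotient (Equiv.Perm.SameCycle.setoid w),
    (∀ x ∈ R.σ, Quotient.mk (Equiv.Perm.SameCycle.setoid w) x = c 0) ∧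
    List.IsChain (fun x y => w x = y) R.σ ∧
    ∀ i, ∀ x ∈ R.τ i, Quotient.mk (Equiv.Perm.SameCycle.setoid w) x = c i}

/-!
Call a family of ideals of rank `d` good if the intersections of two or more of them are strongly
constructible of rank `d - 1`; a good family of strongly constructible ideals has a strongly
constructible union (`IsConstructibleIdeal.biUnion`). The proof enlarges the class of ideals
generated by sets `S_n(R)` to one that is closed under suitable decompositions of this kind.

The larger class consists of the ideals `labelledIdeal σ g`: a permutation `u` belongs to it if it
lies below some `w` whose cycles can be labelled, not necessarily injectively, in such a way that
every point `x` gets a label from a given set `g x`, and the given sequences `σ l`, one for each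
label, are consecutive in cycles of `w`. The rank is `n` minus the number of labels. Two inductions
are nested, an outer one on the number of labels, downwards, and an inner one on the number of
choices still to be made.

* If `x` has several allowed labels, the ideal is the union of those in which one of them is chosen
  (`labelledIdeal_eq_biUnion_update`). If `u` belongs to several of these, the cycle of `x` in `u`
  contains no point whose label is forced by `g` and can be detached, so the
  intersections are again labelled ideals, with one more label (`iInter_labelledIdeal_update`).
* If all labels are forced but `σ i` does not contain all points of label `i`, the ideal is the
  union of those in which `σ i` is continued by one of the remaining points
  (`labelledIdeal_eq_biUnion_appendPoint`). If `u` belongs to those for all points of `T`, at most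
  one point of `T` lies in a cycle of `u` meeting `σ i`, and the others can be detached. Hence the
  intersection is the union of a labelled ideal `X` and further ones `X t`, `t ∈ T`, with one more
  label (`iInter_labelledIdeal_appendPoint`), where `X ∩ X t` is a labelled ideal with two more
  labels and `X t ∩ X t' ⊆ X`.
* If the sequences exhaust all points, the ideal is the interval below a single permutation.

The manipulations rest on one observation (`absolute_le_mul_swap_of_apply_eq`): if `u ≤ w` and
`u a = w y` with `a ≠ y`, then the cycle of `w` can be split between `a` and `y` without leaving
the permutations above `u`. It yields the detaching of cycles
(`exists_absolute_le_invariant`), and it also says that below `w` the cycles of a permutation follow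
those of `w`.

Intervals are shellable by the lexicographic order of their maximal chains (`isPureShellable_Iic`).
The cover `u < u * t` is labelled by the transposition `t`, and the transpositions are ordered by
their smaller point `a` and then by the distance from `a` to `t a` along the cycle of `w`. The
first atom below `v` is then `(a v(a))`, for `a` the smallest point moved by `v`, and a chain that
starts with the first atom in each of its rank two intervals also starts with the first atom of the
interval it spans (`eq_mul_firstSwap_of_forall`).
-/

/-! ### Cycles and reflection length -/

open Equiv Equiv.Perm in
/-- The cycle of `a` in `w * swap a b` runs along the cycle of `b` in `w` until it reaches `a` or
`b`. -/
theorem pow_mul_swap_apply {n : ℕ} (w : Equiv.Perm (Fin n)) (a b : Fin n) (j : ℕ)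
    (h : ∀ i, 1 ≤ i → i < j → (w ^ i) b ≠ a ∧ (w ^ i) b ≠ b) (i : ℕ) (h1 : 1 ≤ i) (hij : i ≤ j) :
    ((w * swap a b) ^ i) a = (w ^ i) b := by
  induction i, h1 using Nat.le_induction with
  | base => simp
  | succ i hi ih =>
    rw [pow_succ', Perm.mul_apply, ih (by omega), Perm.mul_apply,
      swap_apply_of_ne_of_ne (h i hi (by omega)).1 (h i hi (by omega)).2, pow_succ',
      Perm.mul_apply]

open Equiv Equiv.Perm in
/-- Multiplying by a transposition of points in different cycles merges these cycles. -/
theorem sameCycle_mul_swap {n : ℕ} {w : Equiv.Perm (Fin n)} {a b : Fin n}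
    (h : ¬ w.SameCycle a b) : (w * swap a b).SameCycle a b := by
  classical
  have hex : ∃ j, 1 ≤ j ∧ (w ^ j) b = b :=
    ⟨orderOf w, orderOf_pos w, by simp [pow_orderOf_eq_one]⟩
  obtain ⟨hj, hb⟩ := Nat.find_spec hex
  have := pow_mul_swap_apply w a b (Nat.find hex) (fun i h1 hi =>
    ⟨fun e => h ⟨-i, by rw [← e]; simp⟩, fun e => Nat.find_min hex hi ⟨h1, e⟩⟩) _ hj le_rfl
  exact ⟨Nat.find hex, by rw [zpow_natCast, this, hb]⟩

open Equiv Equiv.Perm in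
/-- Multiplying by a transposition of points in one cycle separates them. -/
theorem not_sameCycle_mul_swap {n : ℕ} {w : Equiv.Perm (Fin n)} {a b : Fin n}
    (hab : a ≠ b) (h : w.SameCycle a b) : ¬ (w * swap a b).SameCycle a b := by
  classical
  have hex : ∃ j, 1 ≤ j ∧ (w ^ j) b = a := by
    obtain ⟨j, hj, -, e⟩ := h.symm.exists_pow_eq''
    exact ⟨j, hj, e⟩
  obtain ⟨hj, hb⟩ := Nat.find_spec hex
  set j := Nat.find hex with hjdef
  have hmin : ∀ i, 1 ≤ i → i < j → (w ^ i) b ≠ a ∧ (w ^ i) b ≠ b := by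
    refine fun i h1 hi => ⟨fun e => Nat.find_min hex hi ⟨h1, e⟩, fun e => ?_⟩
    refine Nat.find_min hex (m := j - i) (by omega) ⟨by omega, ?_⟩
    have : (w ^ j) b = (w ^ (j - i)) ((w ^ i) b) := by
      rw [← Perm.mul_apply, ← pow_add]; congr 2; omega
    rw [← hb, this, e]
  have hw := pow_mul_swap_apply w a b j hmin
  intro hs
  have hper : ((w * swap a b) ^ j) a = a := by rw [hw j hj le_rfl, hb]
  obtain ⟨m, -, -, hm⟩ := hs.exists_pow_eq''
  have hmod : ((w * swap a b) ^ (m % j)) a = b := by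
    conv at hm => rw [← Nat.mod_add_div m j, pow_add, pow_mul, Perm.mul_apply]
    rwa [Perm.pow_apply_eq_self_of_apply_eq_self hper] at hm
  rcases Nat.eq_zero_or_pos (m % j) with h0 | h0
  · rw [h0] at hmod; exact hab (by simpa using hmod)
  · have hlt := Nat.mod_lt m hj
    rw [hw _ h0 hlt.le] at hmod
    exact (hmin _ h0 hlt).2 hmod

open Equiv Equiv.Perm in
theorem sameCycle_of_forall_apply {n : ℕ} {w w' : Equiv.Perm (Fin n)}
    (h : ∀ x, w'.SameCycle x (w x)) {x y : Fin n} (hxy : w.SameCycle x y) : w'.SameCycle x y := by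
  obtain ⟨m, rfl⟩ := hxy.exists_nat_pow_eq
  induction m with
  | zero => exact SameCycle.refl _ _
  | succ m ih =>
    rw [pow_succ', Perm.mul_apply]
    exact (ih ⟨m, by simp⟩).trans (h _)

open Equiv Equiv.Perm in
theorem apply_eq_of_sameCycle {n : ℕ} {β : Type*} {w : Equiv.Perm (Fin n)}
    {f : Fin n → β} (hf : ∀ x, f (w x) = f x) {x y : Fin n} (h : w.SameCycle x y) : f x = f y := by
  obtain ⟨m, rfl⟩ := h.exists_nat_pow_eq
  induction m with
  | zero => rfl
  | succ m ih => rw [pow_succ', Perm.mul_apply, hf]; exact ih ⟨m, by simp⟩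

open Equiv Equiv.Perm in
theorem sameCycle_mul_swap_of_sameCycle {n : ℕ} {w : Equiv.Perm (Fin n)} {a b : Fin n}
    (h : ¬ w.SameCycle a b) {x y : Fin n} (hxy : w.SameCycle x y) :
    (w * swap a b).SameCycle x y := by
  have hab := sameCycle_mul_swap h
  refine sameCycle_of_forall_apply (fun z => ?_) hxy
  by_cases hza : z = a
  · subst hza
    exact hab.trans ⟨1, by simp⟩
  by_cases hzb : z = b
  · subst hzb
    exact hab.symm.trans ⟨1, by simp⟩
  · exact ⟨1, by simp [swap_apply_of_ne_of_ne hza hzb]⟩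

/-- The number of cycles of a permutation, fixed points included. -/
noncomputable def cycleCount {n : ℕ} (w : Equiv.Perm (Fin n)) : ℕ :=
  Nat.card (Quotient (Equiv.Perm.SameCycle.setoid w))

open Equiv Equiv.Perm in
theorem cycleCount_mul_swap {n : ℕ} {w : Equiv.Perm (Fin n)} {a b : Fin n}
    (h : ¬ w.SameCycle a b) : cycleCount (w * swap a b) + 1 = cycleCount w := by
  classical
  let s := SameCycle.setoid w
  let s' := SameCycle.setoid (w * swap a b)
  have hab : a ≠ b := fun e => h (e ▸ SameCycle.refl _ _)
  have key : ∀ x y, w.SameCycle x y → Quotient.mk s x = Quotient.mk s y :=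
    fun x y hxy => Quotient.sound hxy
  let f : Fin n → Quotient s := fun x =>
    if Quotient.mk s x = Quotient.mk s b then Quotient.mk s a else Quotient.mk s x
  have hwx : ∀ x, Quotient.mk s (w x) = Quotient.mk s x := fun x => (key _ _ ⟨1, by simp⟩).symm
  have hf : ∀ x, f ((w * swap a b) x) = f x := by
    intro x
    have hne : Quotient.mk s a ≠ Quotient.mk s b := fun e => h (Quotient.exact e)
    by_cases hxa : x = a
    · subst hxa; simp [f, hwx]
    by_cases hxb : x = b
    · subst hxb; simp [f, hwx, hne]
    · simp [f, swap_apply_of_ne_of_ne hxa hxb, hwx]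
  let F : Quotient s' → {q : Quotient s // q ≠ Quotient.mk s b} :=
    fun q => Quotient.liftOn q (fun x => ⟨f x, by
      by_cases hx : Quotient.mk s x = Quotient.mk s b
      · simp only [f, hx, if_true]; exact fun e => h (Quotient.exact e)
      · simp only [f]
        rwa [if_neg hx]⟩)
      (fun x y hxy => Subtype.ext (apply_eq_of_sameCycle hf hxy))
  have hF : Function.Bijective F := by
    constructor
    · intro q q' hq
      induction q using Quotient.inductionOn with | _ x
      induction q' using Quotient.inductionOn with | _ y
      have hq : f x = f y := congrArg Subtype.val hq
      have step : ∀ x, ∃ x', (w * swap a b).SameCycle x x' ∧ Quotient.mk s x' = f x := by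
        intro x
        by_cases hx : Quotient.mk s x = Quotient.mk s b
        · refine ⟨a, ?_, by simp only [f, hx, if_true]⟩
          exact (sameCycle_mul_swap_of_sameCycle h (Quotient.exact hx)).trans (sameCycle_mul_swap h).symm
        · exact ⟨x, SameCycle.refl _ _, by simp only [f, hx, if_false]⟩
      obtain ⟨x', hx, ex⟩ := step x
      obtain ⟨y', hy, ey⟩ := step y
      refine Quotient.sound (hx.trans (SameCycle.trans ?_ hy.symm))
      exact sameCycle_mul_swap_of_sameCycle h (Quotient.exact (ex.trans (hq.trans ey.symm)))
    · rintro ⟨q, hq⟩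
      induction q using Quotient.inductionOn with | _ x
      exact ⟨Quotient.mk s' x, Subtype.ext (by
        change f x = _
        simp only [f]; rw [if_neg hq])⟩
  have h1 : Nat.card (Quotient s') = Nat.card {q : Quotient s // q ≠ Quotient.mk s b} :=
    Nat.card_eq_of_bijective F hF
  unfold cycleCount
  change Nat.card (Quotient s') + 1 = Nat.card (Quotient s)
  rw [h1, Nat.card_eq_fintype_card, Nat.card_eq_fintype_card, Fintype.card_subtype_compl,
    Fintype.card_subtype_eq]
  have : 0 < Fintype.card (Quotient s) := Fintype.card_pos_iff.2 ⟨Quotient.mk s b⟩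
  omega

open Equiv Equiv.Perm in
theorem mul_swap_mul_swap {n : ℕ} (w : Equiv.Perm (Fin n)) (a b : Fin n) :
    w * swap a b * swap a b = w := by
  rw [mul_assoc, swap_mul_self, mul_one]

open Equiv Equiv.Perm in
theorem cycleCount_mul_swap_of_sameCycle {n : ℕ} {w : Equiv.Perm (Fin n)} {a b : Fin n}
    (hab : a ≠ b) (h : w.SameCycle a b) : cycleCount (w * swap a b) = cycleCount w + 1 := by
  have := cycleCount_mul_swap (not_sameCycle_mul_swap hab h)
  rw [mul_swap_mul_swap] at this
  exact this.symm

theorem cycleCount_one {n : ℕ} : cycleCount (1 : Equiv.Perm (Fin n)) = n := by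
  have : Function.Bijective (Quotient.mk (Equiv.Perm.SameCycle.setoid (1 : Equiv.Perm (Fin n)))) :=
    ⟨fun x y h => Equiv.Perm.sameCycle_one.1 (Quotient.exact h), Quotient.mk_surjective⟩
  rw [cycleCount, ← Nat.card_eq_of_bijective _ this, Nat.card_fin]

open Equiv Equiv.Perm in
theorem le_length_add_cycleCount {n : ℕ} (l : List (Equiv.Perm (Fin n))) (hl : ∀ t ∈ l, t.IsSwap) :
    n ≤ l.length + cycleCount l.prod := by
  induction l using List.reverseRecOn with
  | nil => simp [cycleCount_one]
  | append_singleton l t ih =>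
    have ih := ih fun t ht => hl t (by simp [ht])
    obtain ⟨a, b, hab, rfl⟩ := hl t (by simp)
    rw [List.prod_append, List.prod_singleton, List.length_append, List.length_singleton]
    by_cases h : l.prod.SameCycle a b
    · rw [cycleCount_mul_swap_of_sameCycle hab h]; omega
    · have := cycleCount_mul_swap h; omega

open Equiv Equiv.Perm in
theorem cycleCount_le {n : ℕ} (w : Equiv.Perm (Fin n)) : cycleCount w ≤ n := by
  have := Nat.card_le_card_of_surjective _
    (Quotient.mk_surjective (s := SameCycle.setoid w))
  rwa [Nat.card_fin] at this

open Equiv Equiv.Perm in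
theorem exists_length_add_cycleCount {n : ℕ} (w : Equiv.Perm (Fin n)) :
    ∃ l : List (Equiv.Perm (Fin n)), (∀ t ∈ l, t.IsSwap) ∧ l.prod = w ∧
      l.length + cycleCount w = n := by
  induction hm : n - cycleCount w using Nat.strong_induction_on generalizing w with
  | _ m ih =>
    by_cases hw : w = 1
    · subst hw; exact ⟨[], by simp, by simp, by simp [cycleCount_one]⟩
    · obtain ⟨a, ha⟩ : ∃ a, w a ≠ a := by
        by_contra! h; exact hw (Equiv.ext h)
      have h1 := cycleCount_mul_swap_of_sameCycle (w := w) ha.symm ⟨1, by simp⟩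
      have h2 := cycleCount_le (w * swap a (w a))
      obtain ⟨l, h3, h4, h5⟩ := ih _ (by omega) (w * swap a (w a)) rfl
      refine ⟨l ++ [swap a (w a)], ?_, ?_, ?_⟩
      · intro t ht
        rcases List.mem_append.1 ht with ht | ht
        · exact h3 t ht
        · rw [List.mem_singleton.1 ht]; exact ⟨a, w a, ha.symm, rfl⟩
      · rw [List.prod_append, h4, List.prod_singleton, mul_swap_mul_swap]
      · rw [List.length_append, List.length_singleton]; omega

/-- A factorization into transpositions can save at most one cycle per factor, and splitting off
one moved point at a time attains this bound. -/
theorem reflectionLength_add_cycleCount {n : ℕ} (w : Equiv.Perm (Fin n)) :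
    reflectionLength w + cycleCount w = n := by
  obtain ⟨l, h1, h2, h3⟩ := exists_length_add_cycleCount w
  have h4 := reflectionLength_le l h1
  obtain ⟨m, k1, k2, k3⟩ := reflectionLength_spec w
  have h5 := le_length_add_cycleCount m k1
  rw [h2] at h4
  rw [k2] at h5
  omega

open Equiv Equiv.Perm in
theorem reflectionLength_mul_swap {n : ℕ} {w : Equiv.Perm (Fin n)} {a b : Fin n}
    (h : ¬ w.SameCycle a b) : reflectionLength (w * swap a b) = reflectionLength w + 1 := by
  have h1 := reflectionLength_add_cycleCount w
  have h2 := reflectionLength_add_cycleCount (w * swap a b)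
  have h3 := cycleCount_mul_swap h
  omega

open Equiv Equiv.Perm in
theorem reflectionLength_mul_swap_of_sameCycle {n : ℕ} {w : Equiv.Perm (Fin n)} {a b : Fin n}
    (hab : a ≠ b) (h : w.SameCycle a b) :
    reflectionLength (w * swap a b) + 1 = reflectionLength w := by
  have h1 := reflectionLength_add_cycleCount w
  have h2 := reflectionLength_add_cycleCount (w * swap a b)
  have h3 := cycleCount_mul_swap_of_sameCycle hab h
  omega

theorem reflectionLength_le_inv {n : ℕ} (w : Equiv.Perm (Fin n)) :
    reflectionLength w⁻¹ ≤ reflectionLength w := by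
  obtain ⟨l, h1, h2, h3⟩ := reflectionLength_spec w
  have := reflectionLength_le (l.map (·⁻¹)).reverse (by
    intro t ht
    obtain ⟨s, hs, rfl⟩ := List.mem_map.1 (List.mem_reverse.1 ht)
    obtain ⟨a, b, hab, rfl⟩ := h1 s hs
    exact ⟨a, b, hab, by simp⟩)
  rw [← List.prod_inv_reverse, h2] at this
  simpa [h3] using this

theorem reflectionLength_inv {n : ℕ} (w : Equiv.Perm (Fin n)) :
    reflectionLength w⁻¹ = reflectionLength w :=
  le_antisymm (reflectionLength_le_inv w) (by simpa using reflectionLength_le_inv w⁻¹)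

theorem reflectionLength_conj_le {n : ℕ} (g w : Equiv.Perm (Fin n)) :
    reflectionLength (g * w * g⁻¹) ≤ reflectionLength w := by
  obtain ⟨l, h1, h2, h3⟩ := reflectionLength_spec w
  have := reflectionLength_le (l.map (MulAut.conj g)) (by
    intro t ht
    obtain ⟨s, hs, rfl⟩ := List.mem_map.1 ht
    obtain ⟨a, b, hab, rfl⟩ := h1 s hs
    exact ⟨g a, g b, fun e => hab (g.injective e), by
      rw [MulAut.conj_apply, Equiv.swap_apply_apply]⟩)
  rw [← map_list_prod, h2, List.length_map, h3] at this
  simpa using this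

theorem reflectionLength_conj {n : ℕ} (g w : Equiv.Perm (Fin n)) :
    reflectionLength (g * w * g⁻¹) = reflectionLength w :=
  le_antisymm (reflectionLength_conj_le g w) (by
    simpa [mul_assoc] using reflectionLength_conj_le g⁻¹ (g * w * g⁻¹))

theorem reflectionLength_swap {n : ℕ} {a b : Fin n} (h : a ≠ b) :
    reflectionLength (Equiv.swap a b) = 1 := by
  have := reflectionLength_mul_swap (w := 1) (a := a) (b := b) (by simpa using h)
  simpa [reflectionLength_one] using this

theorem exists_eq_swap_of_reflectionLength {n : ℕ} {w : Equiv.Perm (Fin n)}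
    (h : reflectionLength w = 1) : ∃ a b, a ≠ b ∧ w = Equiv.swap a b := by
  obtain ⟨l, h1, h2, h3⟩ := reflectionLength_spec w
  rw [h, List.length_eq_one_iff] at h3
  obtain ⟨t, rfl⟩ := h3
  obtain ⟨a, b, hab, rfl⟩ := h1 t (by simp)
  exact ⟨a, b, hab, by simpa using h2.symm⟩

/-! ### The absolute order -/

theorem absolute_le_iff {n : ℕ} {u v : Equiv.Perm (Fin n)} :
    u ≤ v ↔ reflectionLength u + reflectionLength (u⁻¹ * v) = reflectionLength v := Iff.rfl

theorem absolute_one_le {n : ℕ} (w : Equiv.Perm (Fin n)) : 1 ≤ w := by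
  rw [absolute_le_iff]; simp [reflectionLength_one]

theorem reflectionLength_mono {n : ℕ} {u v : Equiv.Perm (Fin n)} (h : u ≤ v) :
    reflectionLength u ≤ reflectionLength v := by
  rw [absolute_le_iff] at h; omega

theorem eq_of_absolute_le {n : ℕ} {u v : Equiv.Perm (Fin n)} (h : u ≤ v)
    (hl : reflectionLength v ≤ reflectionLength u) : u = v := by
  rw [absolute_le_iff] at h
  exact inv_mul_eq_one.1 (eq_one_of_reflectionLength (by omega))

theorem absolute_le_of_add_le {n : ℕ} {u v : Equiv.Perm (Fin n)}
    (h : reflectionLength u + reflectionLength (u⁻¹ * v) ≤ reflectionLength v) : u ≤ v := by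
  have := reflectionLength_mul_le u (u⁻¹ * v)
  rw [mul_inv_cancel_left] at this
  exact le_antisymm h this

theorem inv_mul_absolute_le {n : ℕ} {u v : Equiv.Perm (Fin n)} (h : u ≤ v) : u⁻¹ * v ≤ v := by
  apply absolute_le_of_add_le
  have := reflectionLength_conj v⁻¹ u
  rw [absolute_le_iff] at h
  rw [show (u⁻¹ * v)⁻¹ * v = v⁻¹ * u * v⁻¹⁻¹ by group, this]
  omega

/-- Left translation by `x⁻¹` embeds the interval above `x`. -/
theorem inv_mul_absolute_le_inv_mul {n : ℕ} {x y z : Equiv.Perm (Fin n)} (hxy : x ≤ y)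
    (hyz : y ≤ z) : x⁻¹ * y ≤ x⁻¹ * z := by
  have hxz := hxy.trans hyz
  rw [absolute_le_iff] at *
  rw [show (x⁻¹ * y)⁻¹ * (x⁻¹ * z) = y⁻¹ * z by group]
  omega

theorem absolute_le_mul_swap {n : ℕ} {w : Equiv.Perm (Fin n)} {a b : Fin n}
    (h : ¬ w.SameCycle a b) : w ≤ w * Equiv.swap a b := by
  apply absolute_le_of_add_le
  have hab : a ≠ b := fun e => h (e ▸ Equiv.Perm.SameCycle.refl _ _)
  rw [inv_mul_cancel_left, reflectionLength_swap hab, reflectionLength_mul_swap h]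

theorem mul_swap_absolute_le {n : ℕ} {w : Equiv.Perm (Fin n)} {a b : Fin n}
    (hab : a ≠ b) (h : w.SameCycle a b) : w * Equiv.swap a b ≤ w := by
  have := absolute_le_mul_swap (not_sameCycle_mul_swap hab h)
  rwa [mul_swap_mul_swap] at this

open Equiv Equiv.Perm in
/-- The cycle partition of a smaller permutation refines that of a larger one. -/
theorem sameCycle_of_absolute_le {n : ℕ} {u w : Equiv.Perm (Fin n)} (h : u ≤ w) {x y : Fin n}
    (hxy : u.SameCycle x y) : w.SameCycle x y := by
  induction hm : reflectionLength w - reflectionLength u using Nat.strong_induction_on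
    generalizing u with
  | _ m ih =>
    by_cases hv : u⁻¹ * w = 1
    · rwa [← inv_mul_eq_one.1 hv]
    obtain ⟨a, ha⟩ : ∃ a, (u⁻¹ * w)⁻¹ a ≠ a := by
      by_contra! h; exact hv (inv_eq_one.1 (Equiv.ext h))
    set v := u⁻¹ * w with hvdef
    -- Split the transposition `(a v⁻¹(a))` off `v` on the left.
    set b := v⁻¹ a
    have hl := reflectionLength_mul_swap_of_sameCycle (w := v⁻¹) ha.symm ⟨1, by simp [b]⟩
    rw [← reflectionLength_inv, reflectionLength_inv v, mul_inv_rev, swap_inv, inv_inv] at hl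
    rw [absolute_le_iff, ← hvdef] at h
    have h1 : w = u * swap a b * (swap a b * v) := by
      rw [mul_assoc, ← mul_assoc (swap a b), swap_mul_self, one_mul, hvdef, mul_inv_cancel_left]
    have h2 := reflectionLength_mul_le (u * swap a b) (swap a b * v)
    rw [← h1] at h2
    have hnot : ¬ u.SameCycle a b := by
      intro hs
      have := reflectionLength_mul_swap_of_sameCycle ha.symm hs
      omega
    have h3 := reflectionLength_mul_swap hnot
    have h4 : u * swap a b ≤ w := by
      apply absolute_le_of_add_le
      rw [show (u * swap a b)⁻¹ * w = swap a b * v by rw [mul_inv_rev, swap_inv, mul_assoc]]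
      omega
    exact ih _ (by omega) h4 (sameCycle_mul_swap_of_sameCycle hnot hxy) rfl

theorem apply_eq_self_of_absolute_le {n : ℕ} {u w : Equiv.Perm (Fin n)} (h : u ≤ w) {x : Fin n}
    (hx : w x = x) : u x = x := by
  have : w.SameCycle x (u x) := sameCycle_of_absolute_le h ⟨1, by simp⟩
  exact (this.eq_of_left hx).symm

theorem apply_eq_of_absolute_le {n : ℕ} {β : Type*} {u w : Equiv.Perm (Fin n)} (h : u ≤ w)
    {f : Fin n → β} (hf : ∀ x, f (w x) = f x) (x : Fin n) : f (u x) = f x :=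
  (apply_eq_of_sameCycle hf (sameCycle_of_absolute_le h ⟨1, by simp⟩)).symm

open Equiv Equiv.Perm in
/-- If `u ≤ w` and `u` maps `a` to the `w`-image of another element `y`, then `a` and `y` lie in
the same cycle of `u⁻¹ w`, so splitting the cycle of `w` between them leaves a permutation
above `u`. -/
theorem absolute_le_mul_swap_of_apply_eq {n : ℕ} {u w : Equiv.Perm (Fin n)} (h : u ≤ w)
    {a y : Fin n} (hay : a ≠ y) (e : u a = w y) :
    u ≤ w * swap a y ∧ w * swap a y ≤ w ∧
      reflectionLength (w * swap a y) < reflectionLength w := by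
  have hv : (u⁻¹ * w).SameCycle a y :=
    SameCycle.symm ⟨1, by simp [← e]⟩
  have h1 := reflectionLength_mul_swap_of_sameCycle hay hv
  have hw : w.SameCycle a y := by
    have h2 : w.SameCycle a (w y) := sameCycle_of_absolute_le h ⟨1, by simp [e]⟩
    exact h2.trans (SameCycle.symm ⟨1, by simp⟩)
  have h3 := reflectionLength_mul_swap_of_sameCycle hay hw
  refine ⟨absolute_le_of_add_le ?_, mul_swap_absolute_le hay hw, by omega⟩
  rw [absolute_le_iff] at h
  rw [← mul_assoc]
  omega

open Equiv Equiv.Perm in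
/-- If `u ≤ w` and `D` is a union of cycles of `u`, then below `w` there is still a permutation
above `u` for which `D` is a union of cycles and that follows `w` outside `D`. -/
theorem exists_absolute_le_invariant {n : ℕ} {u w : Equiv.Perm (Fin n)} (h : u ≤ w)
    (D : Set (Fin n)) (hD : ∀ x, u x ∈ D ↔ x ∈ D) :
    ∃ w', u ≤ w' ∧ w' ≤ w ∧ (∀ x, w' x ∈ D ↔ x ∈ D) ∧
      ∀ x, x ∉ D → w x ∉ D → w' x = w x := by
  induction hm : reflectionLength w using Nat.strong_induction_on generalizing w with
  | _ m ih =>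
    by_cases hy : ∃ y, y ∉ D ∧ w y ∈ D
    · obtain ⟨y, hyD, hwy⟩ := hy
      have ha : u (u⁻¹ (w y)) = w y := by simp
      have haD : u⁻¹ (w y) ∈ D := by rw [← hD, ha]; exact hwy
      set a := u⁻¹ (w y)
      have hay : a ≠ y := fun e => hyD (e ▸ haD)
      obtain ⟨h1, h2, h3⟩ := absolute_le_mul_swap_of_apply_eq h hay ha
      obtain ⟨w', k1, k2, k3, k4⟩ := ih _ (hm ▸ h3) h1 rfl
      refine ⟨w', k1, k2.trans h2, k3, fun x hx hwx => ?_⟩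
      have hxa : x ≠ a := fun e => hx (e ▸ haD)
      have hxy : x ≠ y := fun e => hwx (e ▸ hwy)
      have e : (w * swap a y) x = w x := by
        rw [Perm.mul_apply, swap_apply_of_ne_of_ne hxa hxy]
      rw [k4 x hx (by rwa [e]), e]
    · push Not at hy
      have hmaps : ∀ x ∈ Dᶜ, w x ∈ Dᶜ := hy
      have hinv : ∀ x, w x ∈ D ↔ x ∈ D := by
        intro x
        constructor
        · intro hx; by_contra hc; exact hy x hc hx
        · intro hx
          by_contra hc
          have hsurj : w '' Dᶜ = Dᶜ := Set.eq_of_subset_of_ncard_le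
            (Set.image_subset_iff.2 hmaps) (Set.ncard_image_of_injective _ w.injective).ge
          obtain ⟨z, hz, e⟩ := hsurj.symm.subset hc
          exact hz (w.injective e ▸ hx)
      exact ⟨w, h, le_rfl, hinv, fun _ _ _ => rfl⟩

/-! ### Shellability of intervals -/

/-- A shelling criterion: if the facets carry an injective key and every facet `F` with a
predecessor `G` can be exchanged in one element towards a predecessor `H` with `G ∩ F ⊆ H`, then
ordering the facets by their key is a shelling. -/
theorem isPureShellable_of_key {α K : Type*} [DecidableEq α] [LinearOrder K]
    {Δ : Set (Finset α)} {d : ℕ} (hfin : (complexFacets Δ).Finite)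
    (hne : ∃ F ∈ Δ, F.card = d + 1) (hle : ∀ F ∈ Δ, F.card ≤ d + 1)
    (hcard : ∀ F ∈ complexFacets Δ, F.card = d + 1)
    (key : Finset α → K) (hinj : Set.InjOn key (complexFacets Δ))
    (hex : ∀ F ∈ complexFacets Δ, ∀ G ∈ complexFacets Δ, key G < key F →
      ∃ H ∈ complexFacets Δ, key H < key F ∧ G ∩ F ⊆ H ∧ (H ∩ F).card = d) :
    IsPureShellable Δ := by
  classical
  refine ⟨d, ⟨⟨?_, ?_⟩, ?_⟩, ?_⟩
  · obtain ⟨F, hF, hc⟩ := hne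
    exact ⟨F, hF, by omega⟩
  · intro F hF
    have := hle F hF
    omega
  · intro F hF
    have := hcard F hF
    omega
  set s : Finset K := hfin.toFinset.image key
  have hmem : ∀ i : Fin s.card, ∃ F ∈ complexFacets Δ, key F = s.orderEmbOfFin rfl i := by
    intro i
    have := s.orderEmbOfFin_mem rfl i
    obtain ⟨F, hF, e⟩ := Finset.mem_image.1 this
    exact ⟨F, hfin.mem_toFinset.1 hF, e⟩
  choose G hG hkey using hmem
  have hlt : ∀ i j, key (G i) < key (G j) ↔ i < j := by
    intro i j
    rw [hkey, hkey, OrderEmbedding.lt_iff_lt]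
  have hsurj : ∀ F ∈ complexFacets Δ, ∃ i, G i = F := by
    intro F hF
    have : key F ∈ Set.range (s.orderEmbOfFin rfl) := by
      rw [Finset.range_orderEmbOfFin]
      exact Finset.mem_coe.2 (Finset.mem_image_of_mem _ (hfin.mem_toFinset.2 hF))
    obtain ⟨i, hi⟩ := this
    exact ⟨i, hinj (hG i) hF (by rw [hkey, hi])⟩
  refine ⟨s.card, G, ?_, ?_, ?_⟩
  · intro i j e
    by_contra hij
    rcases lt_or_gt_of_ne hij with h | h
    · exact absurd ((hlt _ _).2 h) (by rw [e]; exact lt_irrefl _)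
    · exact absurd ((hlt _ _).2 h) (by rw [e]; exact lt_irrefl _)
  · ext F
    constructor
    · rintro ⟨i, rfl⟩; exact hG i
    · exact hsurj F
  intro i hi
  have hstep : ∀ j, j < i → ∃ k, k < i ∧ G j ∩ G i ⊆ G k ∩ G i ∧ (G k ∩ G i).card = d := by
    intro j hj
    obtain ⟨H, hH, h1, h2, h3⟩ := hex _ (hG i) _ (hG j) ((hlt _ _).2 hj)
    obtain ⟨k, rfl⟩ := hsurj H hH
    exact ⟨k, (hlt _ _).1 h1, Finset.subset_inter h2 Finset.inter_subset_right, h3⟩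
  refine ⟨⟨?_, ?_⟩, ?_⟩
  · obtain ⟨k, hk, -, hc⟩ := hstep ⟨0, by omega⟩ hi
    exact ⟨G k ∩ G i, ⟨⟨k, hk, Finset.inter_subset_left⟩, Finset.inter_subset_right⟩, by omega⟩
  · rintro F ⟨⟨j, hj, hFj⟩, hFi⟩
    obtain ⟨k, hk, hsub, hc⟩ := hstep j hj
    have := Finset.card_le_card ((Finset.subset_inter hFj hFi).trans hsub)
    omega
  · rintro F ⟨⟨⟨j, hj, hFj⟩, hFi⟩, hmax⟩
    obtain ⟨k, hk, hsub, hc⟩ := hstep j hj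
    have hF := (Finset.subset_inter hFj hFi).trans hsub
    have := hmax ⟨⟨k, hk, Finset.inter_subset_left⟩, Finset.inter_subset_right⟩ hF
    have h2 := Finset.card_le_card this
    have h3 := Finset.card_le_card hF
    omega

/-- The transposition `(a v(a))` for `a` the smallest point moved by `v`; it is the atom below `v`
with the smallest label. -/
noncomputable def firstSwap {n : ℕ} (v : Equiv.Perm (Fin n)) : Equiv.Perm (Fin n) :=
  if h : v.support.Nonempty then Equiv.swap (v.support.min' h) (v (v.support.min' h)) else 1

/-- The label of a transposition `t`, relative to `w`: the smaller point `a` moved by `t`, followed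
by the number of steps needed to get from `a` to `t a` along the cycle of `w`. -/
noncomputable def swapLabel {n : ℕ} (w t : Equiv.Perm (Fin n)) : ℕ ×ₗ ℕ :=
  if h : t.support.Nonempty then
    toLex ((t.support.min' h : ℕ),
      sInf {k | 1 ≤ k ∧ (w ^ k) (t.support.min' h) = t (t.support.min' h)})
  else toLex (0, 0)

theorem min'_support_eq {n : ℕ} {v : Equiv.Perm (Fin n)} {a : Fin n} (ha : v a ≠ a)
    (hmin : ∀ x, v x ≠ x → a ≤ x) (h : v.support.Nonempty) : v.support.min' h = a :=
  le_antisymm (Finset.min'_le _ _ (Equiv.Perm.mem_support.2 ha))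
    (Finset.le_min' _ _ _ fun x hx => hmin x (Equiv.Perm.mem_support.1 hx))

theorem firstSwap_eq {n : ℕ} {v : Equiv.Perm (Fin n)} {a : Fin n} (ha : v a ≠ a)
    (hmin : ∀ x, v x ≠ x → a ≤ x) : firstSwap v = Equiv.swap a (v a) := by
  have h : v.support.Nonempty := ⟨a, Equiv.Perm.mem_support.2 ha⟩
  rw [firstSwap, dif_pos h, min'_support_eq ha hmin h]

theorem swapLabel_eq {n : ℕ} (w : Equiv.Perm (Fin n)) {t : Equiv.Perm (Fin n)} {a : Fin n}
    (ha : t a ≠ a) (hmin : ∀ x, t x ≠ x → a ≤ x) :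
    swapLabel w t = toLex ((a : ℕ), sInf {k | 1 ≤ k ∧ (w ^ k) a = t a}) := by
  have h : t.support.Nonempty := ⟨a, Equiv.Perm.mem_support.2 ha⟩
  rw [swapLabel, dif_pos h, min'_support_eq ha hmin h]

theorem exists_min_moved {n : ℕ} {v : Equiv.Perm (Fin n)} (h : v ≠ 1) :
    ∃ a, v a ≠ a ∧ ∀ x, v x ≠ x → a ≤ x := by
  have hs : v.support.Nonempty := by
    rw [Finset.nonempty_iff_ne_empty, Ne, Equiv.Perm.support_eq_empty_iff]; exact h
  exact ⟨v.support.min' hs, Equiv.Perm.mem_support.1 (Finset.min'_mem _ _),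
    fun x hx => Finset.min'_le _ _ (Equiv.Perm.mem_support.2 hx)⟩

theorem ne_one_of_reflectionLength_pos {n : ℕ} {w : Equiv.Perm (Fin n)}
    (h : 0 < reflectionLength w) : w ≠ 1 := by
  rintro rfl; rw [reflectionLength_one] at h; exact lt_irrefl _ h

theorem eq_swap_apply_of_reflectionLength {n : ℕ} {t : Equiv.Perm (Fin n)}
    (h : reflectionLength t = 1) {a : Fin n} (ha : t a ≠ a) : t = Equiv.swap a (t a) := by
  obtain ⟨c, e, -, rfl⟩ := exists_eq_swap_of_reflectionLength h
  by_cases h1 : a = c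
  · subst h1; simp
  by_cases h2 : a = e
  · subst h2; simp [Equiv.swap_comm]
  · exact absurd (Equiv.swap_apply_of_ne_of_ne h1 h2) ha

theorem firstSwap_of_reflectionLength {n : ℕ} {t : Equiv.Perm (Fin n)}
    (h : reflectionLength t = 1) : firstSwap t = t := by
  obtain ⟨a, ha, hmin⟩ :=
    exists_min_moved (ne_one_of_reflectionLength_pos (by omega : 0 < reflectionLength t))
  rw [firstSwap_eq ha hmin, ← eq_swap_apply_of_reflectionLength h ha]

theorem swap_absolute_le {n : ℕ} {v : Equiv.Perm (Fin n)} {a b : Fin n} (hab : a ≠ b)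
    (h : v.SameCycle a b) : Equiv.swap a b ≤ v := by
  have h1 := inv_mul_absolute_le (mul_swap_absolute_le hab h)
  rwa [mul_inv_rev, mul_assoc, inv_mul_cancel, mul_one, Equiv.swap_inv] at h1

theorem reflectionLength_firstSwap {n : ℕ} {v : Equiv.Perm (Fin n)} (h : v ≠ 1) :
    reflectionLength (firstSwap v) = 1 := by
  obtain ⟨a, ha, hmin⟩ := exists_min_moved h
  rw [firstSwap_eq ha hmin, reflectionLength_swap ha.symm]

theorem firstSwap_absolute_le {n : ℕ} (v : Equiv.Perm (Fin n)) : firstSwap v ≤ v := by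
  by_cases h : v = 1
  · subst h; simp [firstSwap]
  obtain ⟨a, ha, hmin⟩ := exists_min_moved h
  rw [firstSwap_eq ha hmin]
  exact swap_absolute_le ha.symm ⟨1, by simp⟩

theorem exists_pow_eq_of_absolute_le {n : ℕ} {v w : Equiv.Perm (Fin n)} (h : v ≤ w) (a : Fin n) :
    ∃ k, 1 ≤ k ∧ (w ^ k) a = v a := by
  have : w.SameCycle a (v a) := sameCycle_of_absolute_le h ⟨1, by simp⟩
  obtain ⟨k, hk, -, e⟩ := this.exists_pow_eq''
  exact ⟨k, hk, e⟩

theorem swapLabel_injective {n : ℕ} {w t t' : Equiv.Perm (Fin n)} (ht : t ≤ w) (ht' : t' ≤ w)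
    (h1 : reflectionLength t = 1) (h1' : reflectionLength t' = 1)
    (h : swapLabel w t = swapLabel w t') : t = t' := by
  obtain ⟨a, ha, hmin⟩ :=
    exists_min_moved (ne_one_of_reflectionLength_pos (by omega : 0 < reflectionLength t))
  obtain ⟨a', ha', hmin'⟩ :=
    exists_min_moved (ne_one_of_reflectionLength_pos (by omega : 0 < reflectionLength t'))
  rw [swapLabel_eq w ha hmin, swapLabel_eq w ha' hmin', toLex_inj, Prod.mk.injEq] at h
  obtain rfl : a = a' := Fin.ext h.1
  have k1 := (Nat.sInf_mem (exists_pow_eq_of_absolute_le ht a)).2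
  have k2 := (Nat.sInf_mem (exists_pow_eq_of_absolute_le ht' a)).2
  have e : t a = t' a := by
    rw [← k1, ← k2]
    exact congrArg (fun k => (w ^ k) a) h.2
  rw [eq_swap_apply_of_reflectionLength h1 ha, eq_swap_apply_of_reflectionLength h1' ha', e]

open Equiv Equiv.Perm in
/-- Below `w`, the cycles of `v` follow those of `w`: along the cycle of `w` from `a`, the point
`v a` is reached before every other point of the cycle of `a` in `v`. -/
theorem sInf_pow_le_of_absolute_le {n : ℕ} {v w : Equiv.Perm (Fin n)} (h : v ≤ w) {a b : Fin n}
    (hab : v.SameCycle a b) :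
    sInf {k | 1 ≤ k ∧ (w ^ k) a = v a} ≤ sInf {k | 1 ≤ k ∧ (w ^ k) a = b} := by
  have hw : w.SameCycle a b := sameCycle_of_absolute_le h hab
  have hne : ∃ k, 1 ≤ k ∧ (w ^ k) a = b := by
    obtain ⟨k, hk, -, e⟩ := hw.exists_pow_eq''
    exact ⟨k, hk, e⟩
  have hp := Nat.sInf_mem (exists_pow_eq_of_absolute_le h a)
  have hq := Nat.sInf_mem hne
  have pmin := fun k => Nat.notMem_of_lt_sInf (s := {k | 1 ≤ k ∧ (w ^ k) a = v a}) (m := k)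
  have qmin := fun k => Nat.notMem_of_lt_sInf (s := {k | 1 ≤ k ∧ (w ^ k) a = b}) (m := k)
  set p := sInf {k | 1 ≤ k ∧ (w ^ k) a = v a}
  set q := sInf {k | 1 ≤ k ∧ (w ^ k) a = b}
  obtain ⟨p1, p2⟩ : 1 ≤ p ∧ (w ^ p) a = v a := hp
  obtain ⟨q1, q2⟩ : 1 ≤ q ∧ (w ^ q) a = b := hq
  by_contra! hlt
  -- The predecessor `y` of `v a` in `w` can be cut off from `a`, which takes `b` along with it.
  set y := (w ^ (p - 1)) a with hy
  have hwy : v a = w y := by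
    rw [hy, ← Perm.mul_apply, ← pow_succ', Nat.sub_add_cancel p1, p2]
  have hay : a ≠ y := by
    intro e
    exact pmin 1 (by omega) ⟨le_rfl, by rw [pow_one, hwy, ← e]⟩
  have h1 := (absolute_le_mul_swap_of_apply_eq h hay hwy).1
  have hnot : ¬ (w * swap a y).SameCycle a y := by
    apply not_sameCycle_mul_swap hay
    exact ⟨(p - 1 : ℕ), by rw [zpow_natCast]⟩
  have hyb : (w * swap a y).SameCycle y b := by
    have := pow_mul_swap_apply w y a q (fun i hi hiq => ⟨fun e => ?_, fun e => ?_⟩) q q1 le_rfl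
    · rw [swap_comm, q2] at this
      exact ⟨(q : ℕ), by rw [zpow_natCast, this]⟩
    · refine pmin (i + 1) (by omega) ⟨by omega, ?_⟩
      rw [pow_succ', Perm.mul_apply, e, ← hwy]
    · refine qmin (q - i) (by omega) ⟨by omega, ?_⟩
      have : (w ^ q) a = (w ^ (q - i)) ((w ^ i) a) := by
        rw [← Perm.mul_apply, ← pow_add, Nat.sub_add_cancel hiq.le]
      rw [← q2, this, e]
  exact hnot ((sameCycle_of_absolute_le h1 hab).trans hyb.symm)

theorem swapLabel_firstSwap_le {n : ℕ} {t v w : Equiv.Perm (Fin n)} (htv : t ≤ v) (hvw : v ≤ w)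
    (ht : reflectionLength t = 1) : swapLabel w (firstSwap v) ≤ swapLabel w t := by
  have hv : v ≠ 1 := ne_one_of_reflectionLength_pos (by have := reflectionLength_mono htv; omega)
  obtain ⟨a, ha, hmin⟩ := exists_min_moved hv
  obtain ⟨c, hc, hcmin⟩ :=
    exists_min_moved (ne_one_of_reflectionLength_pos (by omega : 0 < reflectionLength t))
  rw [firstSwap_eq ha hmin, swapLabel_eq w hc hcmin, swapLabel_eq w (a := a) (by simpa using ha)
    (fun x hx => by
      by_cases h1 : x = a
      · exact h1.ge
      by_cases h2 : x = v a
      · exact hmin x (by rw [h2]; exact fun e => ha (v.injective e))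
      · exact absurd (Equiv.swap_apply_of_ne_of_ne h1 h2) hx)]
  have hac : a ≤ c := hmin c fun e => hc (apply_eq_self_of_absolute_le htv e)
  rw [Prod.Lex.le_iff]
  rcases hac.lt_or_eq with h | rfl
  · exact Or.inl h
  · refine Or.inr ⟨rfl, ?_⟩
    simp only [ofLex_toLex, Equiv.swap_apply_left]
    exact sInf_pow_le_of_absolute_le hvw (sameCycle_of_absolute_le htv ⟨1, by simp⟩)

/-- A chain each of whose steps is the first one of the rank two interval containing it and its
successor starts with the first step of the whole interval. -/
theorem eq_mul_firstSwap_of_forall {n d : ℕ} {f : ℕ → Equiv.Perm (Fin n)}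
    (hle : ∀ i j, i ≤ j → j ≤ d → f i ≤ f j) (hl : ∀ i ≤ d, reflectionLength (f i) = i)
    {p q : ℕ} (hpq : p < q) (hq : q ≤ d)
    (h : ∀ r, p < r → r < q → f r = f (r - 1) * firstSwap ((f (r - 1))⁻¹ * f (r + 1))) :
    f (p + 1) = f p * firstSwap ((f p)⁻¹ * f q) := by
  induction hm : q - p using Nat.strong_induction_on generalizing p with
  | _ m ih =>
  have hlen : ∀ i j, i ≤ j → j ≤ d → reflectionLength ((f i)⁻¹ * f j) = j - i := by
    intro i j hij hj
    have := hle i j hij hj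
    rw [absolute_le_iff, hl i (hij.trans hj), hl j hj] at this
    omega
  have ht1 := hlen p (p + 1) (by omega) (by omega)
  rcases Nat.lt_or_ge (p + 1) q with hq1 | hq1
  · have ih' := ih _ (by omega) hq1 (fun r h1 h2 => h r (by omega) h2) rfl
    have hgood := h (p + 1) (by omega) hq1
    rw [Nat.add_sub_cancel] at hgood
    set t := (f p)⁻¹ * f (p + 1) with ht
    set v := (f p)⁻¹ * f q with hv
    set v' := (f (p + 1))⁻¹ * f q with hv'
    set s := (f p)⁻¹ * f (p + 1 + 1) with hs
    have hvt : v = t * v' := by rw [hv, ht, hv']; group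
    have hst : s = t * firstSwap v' := by
      rw [hs, ih', ht]; group
    have hts : t = firstSwap s := by rw [ht, hgood]; group
    have hv'v : v' ≤ v := by
      have := inv_mul_absolute_le (inv_mul_absolute_le_inv_mul (hle p (p + 1) (by omega) (by omega))
        (hle (p + 1) q hq1.le hq))
      rwa [show ((f p)⁻¹ * f (p + 1))⁻¹ * ((f p)⁻¹ * f q) = v' by rw [hv']; group] at this
    have hsv : s ≤ v :=
      inv_mul_absolute_le_inv_mul (hle p (p + 1 + 1) (by omega) (by omega))
        (hle (p + 1 + 1) q hq1 hq)
    have hfs : firstSwap v' ≤ s := by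
      have h1 := inv_mul_absolute_le (inv_mul_absolute_le_inv_mul
        (hle p (p + 1) (by omega) (by omega)) (hle (p + 1) (p + 1 + 1) (by omega) (by omega)))
      rwa [show ((f p)⁻¹ * f (p + 1))⁻¹ * ((f p)⁻¹ * f (p + 1 + 1)) = firstSwap v' by
        rw [ih']; group] at h1
    have hvne : v ≠ 1 := ne_one_of_reflectionLength_pos (by
      rw [hv, hlen p q hpq.le hq]; omega)
    obtain ⟨a, ha, hmin⟩ := exists_min_moved hvne
    suffices hta : t = Equiv.swap a (v a) by
      rw [firstSwap_eq ha hmin, ← hta, ht, mul_inv_cancel_left]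
    by_cases hva : v' a = a
    · have e : v a = t a := by rw [hvt, Equiv.Perm.mul_apply, hva]
      rw [e]
      exact eq_swap_apply_of_reflectionLength (by omega) (by rwa [← e])
    · have hmin' : ∀ x, v' x ≠ x → a ≤ x := fun x hx =>
        hmin x fun e => hx (apply_eq_self_of_absolute_le hv'v e)
      have hfa : firstSwap v' a = v' a := by rw [firstSwap_eq hva hmin', Equiv.swap_apply_left]
      have hsa : s a = v a := calc
        s a = t (firstSwap v' a) := by rw [hst]; rfl
        _ = v a := by rw [hfa, hvt]; rfl
      rw [hts, firstSwap_eq (a := a) (by rwa [hsa]) fun x hx =>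
        hmin x fun e => hx (apply_eq_self_of_absolute_le hsv e), hsa]
  · obtain rfl : q = p + 1 := by omega
    rw [firstSwap_of_reflectionLength (by omega), mul_inv_cancel_left]

/-- The maximal chains of the interval below `w`. -/
def maximalChains {n : ℕ} (w : Equiv.Perm (Fin n)) : Set (Finset (Equiv.Perm (Fin n))) :=
  {F | F ∈ orderComplex (Set.Iic w) ∧ F.card = reflectionLength w + 1}

theorem injOn_reflectionLength {n : ℕ} {F : Finset (Equiv.Perm (Fin n))}
    (hF : IsChain (· ≤ ·) (F : Set (Equiv.Perm (Fin n)))) :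
    Set.InjOn reflectionLength (F : Set (Equiv.Perm (Fin n))) := by
  intro x hx y hy e
  rcases hF.total hx hy with h | h
  · exact eq_of_absolute_le h e.ge
  · exact (eq_of_absolute_le h e.le).symm

theorem image_reflectionLength_subset {n : ℕ} {w : Equiv.Perm (Fin n)}
    {F : Finset (Equiv.Perm (Fin n))} (hF : F ∈ orderComplex (Set.Iic w)) :
    F.image reflectionLength ⊆ Finset.range (reflectionLength w + 1) := by
  intro i hi
  obtain ⟨x, hx, rfl⟩ := Finset.mem_image.1 hi
  have := reflectionLength_mono (hF.1 hx)
  exact Finset.mem_range.2 (by omega)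

theorem card_le_of_mem_orderComplex_Iic {n : ℕ} {w : Equiv.Perm (Fin n)}
    {F : Finset (Equiv.Perm (Fin n))} (hF : F ∈ orderComplex (Set.Iic w)) :
    F.card ≤ reflectionLength w + 1 := by
  rw [← Finset.card_image_of_injOn (injOn_reflectionLength hF.2),
    ← Finset.card_range (reflectionLength w + 1)]
  exact Finset.card_le_card (image_reflectionLength_subset hF)

theorem exists_mem_reflectionLength_eq {n : ℕ} {w : Equiv.Perm (Fin n)}
    {F : Finset (Equiv.Perm (Fin n))} (hF : F ∈ maximalChains w) {i : ℕ}
    (hi : i ≤ reflectionLength w) : ∃ x ∈ F, reflectionLength x = i := by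
  have : F.image reflectionLength = Finset.range (reflectionLength w + 1) :=
    Finset.eq_of_subset_of_card_le (image_reflectionLength_subset hF.1) (by
      rw [Finset.card_image_of_injOn (injOn_reflectionLength hF.1.2), hF.2, Finset.card_range])
  exact Finset.mem_image.1 (this ▸ Finset.mem_range.2 (by omega))

open Equiv in
theorem exists_covered_of_absolute_lt {n : ℕ} {u w : Equiv.Perm (Fin n)} (h : u < w) :
    ∃ w', u ≤ w' ∧ w' ≤ w ∧ reflectionLength w' + 1 = reflectionLength w := by
  set v := u⁻¹ * w with hv
  obtain ⟨a, ha⟩ : ∃ a, v a ≠ a := by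
    by_contra! hc
    exact h.ne (inv_mul_eq_one.1 (Equiv.ext hc))
  have hs : v.SameCycle a (v a) := ⟨1, by simp⟩
  have hl := reflectionLength_mul_swap_of_sameCycle ha.symm hs
  have hsw := reflectionLength_swap ha.symm
  have hle := h.le
  rw [absolute_le_iff, ← hv] at hle
  have h1 := reflectionLength_mul_le u (v * swap a (v a))
  have h2 := reflectionLength_mul_le (u * (v * swap a (v a))) (swap a (v a))
  have e : u * (v * swap a (v a)) * swap a (v a) = w := by
    rw [mul_assoc, mul_swap_mul_swap, hv, mul_inv_cancel_left]
  rw [e] at h2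
  refine ⟨u * (v * swap a (v a)), absolute_le_of_add_le ?_, absolute_le_of_add_le ?_, by omega⟩
  · rw [inv_mul_cancel_left]; omega
  · rw [inv_mul_eq_iff_eq_mul.2 e.symm]; omega

/-- Every chain below `w` is contained in a maximal one with `ℓ(w) + 1` elements. -/
theorem exists_maximalChains_superset {n : ℕ} {w : Equiv.Perm (Fin n)}
    {F : Finset (Equiv.Perm (Fin n))} (hF : F ∈ orderComplex (Set.Iic w)) :
    ∃ G ∈ maximalChains w, F ⊆ G := by
  classical
  induction hm : reflectionLength w using Nat.strong_induction_on generalizing w F with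
  | _ m ih =>
  by_cases hw : w = 1
  · subst hw
    refine ⟨{1}, ⟨⟨by simp, by simp⟩, by simp [reflectionLength_one]⟩, fun x hx => ?_⟩
    have hx1 : x ≤ 1 := hF.1 hx
    exact Finset.mem_singleton.2 (le_antisymm hx1 (absolute_one_le x))
  obtain ⟨u, huw, hu⟩ : ∃ u, u < w ∧ ∀ x ∈ F.erase w, x ≤ u := by
    by_cases hE : (F.erase w).Nonempty
    · obtain ⟨u, hu, hmax⟩ := (F.erase w).exists_maximal hE
      have hu' := Finset.mem_erase.1 hu
      refine ⟨u, lt_of_le_of_ne (hF.1 hu'.2) hu'.1, fun x hx => ?_⟩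
      rcases hF.2.total (Finset.mem_of_mem_erase hx) hu'.2 with h | h
      · exact h
      · exact hmax hx h
    · rw [Finset.not_nonempty_iff_eq_empty] at hE
      exact ⟨1, lt_of_le_of_ne (absolute_one_le w) (Ne.symm hw), by simp [hE]⟩
  obtain ⟨w', h1, h2, h3⟩ := exists_covered_of_absolute_lt huw
  obtain ⟨G, hG, hsub⟩ := ih _ (by omega) (w := w') (F := F.erase w)
    ⟨fun x hx => (hu x hx).trans h1,
      hF.2.mono (Finset.coe_subset.2 (Finset.erase_subset _ _))⟩ rfl
  have hwG : w ∉ G := fun h => by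
    have := reflectionLength_mono (hG.1.1 h)
    omega
  refine ⟨insert w G, ⟨⟨?_, ?_⟩, ?_⟩, ?_⟩
  · intro x hx
    rcases Finset.mem_insert.1 hx with rfl | hx
    · exact Set.mem_Iic.2 le_rfl
    · exact (show x ≤ w' from hG.1.1 hx).trans h2
  · rw [Finset.coe_insert]
    exact hG.1.2.insert fun b hb _ => Or.inr ((show b ≤ w' from hG.1.1 hb).trans h2)
  · rw [Finset.card_insert_of_notMem hwG, hG.2, h3]
  · intro x hx
    by_cases hxw : x = w
    · subst hxw; exact Finset.mem_insert_self _ _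
    · exact Finset.mem_insert_of_mem (hsub (Finset.mem_erase.2 ⟨hxw, hx⟩))

theorem complexFacets_orderComplex_Iic {n : ℕ} (w : Equiv.Perm (Fin n)) :
    complexFacets (orderComplex (Set.Iic w)) = maximalChains w := by
  ext F
  constructor
  · rintro ⟨hF, hmax⟩
    obtain ⟨G, hG, hsub⟩ := exists_maximalChains_superset hF
    rwa [show F = G from le_antisymm hsub (hmax hG.1 hsub)]
  · intro hF
    refine ⟨hF.1, fun G hG hsub => ?_⟩
    exact (Finset.eq_of_subset_of_card_le hsub
      (by rw [hF.2]; exact card_le_of_mem_orderComplex_Iic hG)).ge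

/-- The element of length `i` of a maximal chain (and `1` if there is none). -/
noncomputable def chainElement {n : ℕ} (F : Finset (Equiv.Perm (Fin n))) (i : ℕ) :
    Equiv.Perm (Fin n) :=
  open Classical in if h : ∃ x ∈ F, reflectionLength x = i then h.choose else 1

section chainElement

variable {n : ℕ} {w : Equiv.Perm (Fin n)} {F : Finset (Equiv.Perm (Fin n))}

theorem chainElement_mem (hF : F ∈ maximalChains w) {i : ℕ} (hi : i ≤ reflectionLength w) :
    chainElement F i ∈ F := by
  have h := exists_mem_reflectionLength_eq hF hi
  rw [chainElement, dif_pos h]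
  exact h.choose_spec.1

theorem reflectionLength_chainElement (hF : F ∈ maximalChains w) {i : ℕ}
    (hi : i ≤ reflectionLength w) : reflectionLength (chainElement F i) = i := by
  have h := exists_mem_reflectionLength_eq hF hi
  rw [chainElement, dif_pos h]
  exact h.choose_spec.2

theorem eq_chainElement (hF : F ∈ maximalChains w) {x : Equiv.Perm (Fin n)} (hx : x ∈ F) :
    x = chainElement F (reflectionLength x) := by
  have hi := reflectionLength_mono (hF.1.1 hx)
  exact injOn_reflectionLength hF.1.2 hx (chainElement_mem hF hi)
    (reflectionLength_chainElement hF hi).symm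

theorem chainElement_le (hF : F ∈ maximalChains w) {i j : ℕ} (hij : i ≤ j)
    (hj : j ≤ reflectionLength w) : chainElement F i ≤ chainElement F j := by
  rcases hF.1.2.total (chainElement_mem hF (hij.trans hj)) (chainElement_mem hF hj) with h | h
  · exact h
  · have h1 := reflectionLength_mono h
    rw [reflectionLength_chainElement hF hj, reflectionLength_chainElement hF (hij.trans hj)] at h1
    rw [le_antisymm hij h1]

theorem chainElement_zero (hF : F ∈ maximalChains w) : chainElement F 0 = 1 :=
  eq_one_of_reflectionLength (reflectionLength_chainElement hF (Nat.zero_le _))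

theorem chainElement_top (hF : F ∈ maximalChains w) :
    chainElement F (reflectionLength w) = w :=
  eq_of_absolute_le (hF.1.1 (chainElement_mem hF le_rfl))
    (reflectionLength_chainElement hF le_rfl).ge

/-- The quotient of two consecutive elements of a maximal chain. -/
noncomputable def chainStep (F : Finset (Equiv.Perm (Fin n))) (i : ℕ) : Equiv.Perm (Fin n) :=
  (chainElement F i)⁻¹ * chainElement F (i + 1)

theorem reflectionLength_chainStep (hF : F ∈ maximalChains w) {i : ℕ}
    (hi : i < reflectionLength w) : reflectionLength (chainStep F i) = 1 := by
  have := chainElement_le hF (by omega : i ≤ i + 1) hi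
  rw [absolute_le_iff, reflectionLength_chainElement hF hi.le,
    reflectionLength_chainElement hF hi] at this
  rw [chainStep]; omega

theorem chainStep_le_of_le (hF : F ∈ maximalChains w) {i j : ℕ} (hij : i + 1 ≤ j)
    (hj : j ≤ reflectionLength w) : chainStep F i ≤ (chainElement F i)⁻¹ * chainElement F j :=
  inv_mul_absolute_le_inv_mul (chainElement_le hF (Nat.le_succ i) (hij.trans hj))
    (chainElement_le hF hij hj)

theorem inv_chainElement_mul_le (hF : F ∈ maximalChains w) {i j : ℕ} (hij : i ≤ j)
    (hj : j ≤ reflectionLength w) : (chainElement F i)⁻¹ * chainElement F j ≤ w :=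
  (inv_mul_absolute_le (chainElement_le hF hij hj)).trans (hF.1.1 (chainElement_mem hF hj))

/-- The sequence of labels of a maximal chain, to be compared lexicographically. -/
noncomputable def chainKey (w : Equiv.Perm (Fin n)) (F : Finset (Equiv.Perm (Fin n))) :
    Lex (Fin (reflectionLength w) → ℕ ×ₗ ℕ) :=
  toLex fun i => swapLabel w (chainStep F i)

theorem chainElement_eq_of_labels {G : Finset (Equiv.Perm (Fin n))} (hF : F ∈ maximalChains w)
    (hG : G ∈ maximalChains w) {p : ℕ} (hp : p ≤ reflectionLength w)
    (h : ∀ i < p, swapLabel w (chainStep F i) = swapLabel w (chainStep G i)) :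
    ∀ i ≤ p, chainElement F i = chainElement G i := by
  intro i hi
  induction i with
  | zero => rw [chainElement_zero hF, chainElement_zero hG]
  | succ i ih =>
    have e := swapLabel_injective (inv_chainElement_mul_le hF (Nat.le_succ i) (by omega))
      (inv_chainElement_mul_le hG (Nat.le_succ i) (by omega))
      (reflectionLength_chainStep hF (by omega)) (reflectionLength_chainStep hG (by omega))
      (h i (by omega))
    rw [ih (by omega)] at e
    exact mul_left_cancel e

theorem eq_of_chainElement_eq {G : Finset (Equiv.Perm (Fin n))} (hF : F ∈ maximalChains w)
    (hG : G ∈ maximalChains w)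
    (h : ∀ i ≤ reflectionLength w, chainElement F i = chainElement G i) : F = G := by
  have hsub : F ⊆ G := by
    intro x hx
    have hi := reflectionLength_mono (hF.1.1 hx)
    rw [eq_chainElement hF hx, h _ hi]
    exact chainElement_mem hG hi
  exact Finset.eq_of_subset_of_card_le hsub (by rw [hF.2, hG.2])

theorem chainKey_injOn : Set.InjOn (chainKey w) (maximalChains w) := by
  intro F hF G hG e
  exact eq_of_chainElement_eq hF hG (chainElement_eq_of_labels hF hG le_rfl fun i hi =>
    congrFun (toLex_inj.1 e) ⟨i, hi⟩)

theorem chainElement_eq_of_mem (hF : F ∈ maximalChains w) {x : Equiv.Perm (Fin n)} (hx : x ∈ F)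
    {i : ℕ} (hi : reflectionLength x = i) : chainElement F i = x := by
  subst hi; exact (eq_chainElement hF hx).symm

/-- A step of a maximal chain that is not the first one of its rank two interval can be replaced,
which makes the chain lexicographically smaller. -/
theorem exists_smaller_maximalChains (hF : F ∈ maximalChains w) {r : ℕ} (h0 : 0 < r)
    (hr : r < reflectionLength w)
    (hne : chainElement F r ≠ chainElement F (r - 1) *
      firstSwap ((chainElement F (r - 1))⁻¹ * chainElement F (r + 1))) :
    ∃ H ∈ maximalChains w, chainKey w H < chainKey w F ∧ F.erase (chainElement F r) ⊆ H ∧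
      chainElement F r ∉ H := by
  classical
  obtain ⟨s, rfl⟩ : ∃ s, r = s + 1 := ⟨r - 1, by omega⟩
  rw [Nat.add_sub_cancel] at hne
  set x := chainElement F s with hx
  set z := chainElement F (s + 1 + 1) with hz
  have hxz : x ≤ z := chainElement_le hF (by omega) (by omega)
  have hlx : reflectionLength x = s := reflectionLength_chainElement hF (by omega)
  have hlz : reflectionLength z = s + 1 + 1 := reflectionLength_chainElement hF (by omega)
  set v := x⁻¹ * z with hv
  have hlv : reflectionLength v = 2 := by
    rw [absolute_le_iff, ← hv] at hxz; omega
  have hv1 : v ≠ 1 := ne_one_of_reflectionLength_pos (by omega)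
  set y := x * firstSwap v with hy
  have hfv := firstSwap_absolute_le v
  have hlf := reflectionLength_firstSwap hv1
  have hfz : reflectionLength ((firstSwap v)⁻¹ * v) = 1 := by
    rw [absolute_le_iff] at hfv; omega
  have hyz' : y⁻¹ * z = (firstSwap v)⁻¹ * v := by rw [hy, hv]; group
  have hly : reflectionLength y = s + 1 := by
    have h1 := reflectionLength_mul_le x (firstSwap v)
    have h2 := reflectionLength_mul_le y (y⁻¹ * z)
    rw [mul_inv_cancel_left, hyz', hfz] at h2
    rw [← hy] at h1
    omega
  have hxy : x ≤ y := by
    apply absolute_le_of_add_le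
    rw [hy, inv_mul_cancel_left, ← hy]; omega
  have hyz : y ≤ z := by
    apply absolute_le_of_add_le
    rw [hyz']; omega
  have hzw : z ≤ w := hF.1.1 (chainElement_mem hF (by omega))
  set m := chainElement F (s + 1) with hm
  have hmF : m ∈ F := chainElement_mem hF hr.le
  have hlm : reflectionLength m = s + 1 := reflectionLength_chainElement hF hr.le
  have hrest : ∀ b ∈ F.erase m, reflectionLength b ≠ s + 1 := by
    intro b hb e
    obtain ⟨h1, h2⟩ := Finset.mem_erase.1 hb
    exact h1 (injOn_reflectionLength hF.1.2 h2 hmF (by rw [e, hlm]))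
  have hyE : y ∉ F.erase m := fun h => hrest y h hly
  have hH : insert y (F.erase m) ∈ maximalChains w := by
    refine ⟨⟨?_, ?_⟩, ?_⟩
    · intro b hb
      rcases Finset.mem_insert.1 hb with rfl | hb
      · exact hyz.trans hzw
      · exact hF.1.1 (Finset.mem_of_mem_erase hb)
    · rw [Finset.coe_insert]
      refine (hF.1.2.mono (Finset.coe_subset.2 (Finset.erase_subset _ _))).insert fun b hb _ => ?_
      have hbF := Finset.mem_of_mem_erase hb
      have hb' := hrest b hb
      have hbw := reflectionLength_mono (hF.1.1 hbF)
      have hbe := eq_chainElement hF hbF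
      rcases Nat.lt_or_ge (reflectionLength b) (s + 1) with h | h
      · right
        rw [hbe]
        exact (chainElement_le hF (by omega) (by omega)).trans hxy
      · left
        rw [hbe]
        exact hyz.trans (chainElement_le hF (by omega) hbw)
    · rw [Finset.card_insert_of_notMem hyE, Finset.card_erase_of_mem hmF, hF.2]; omega
  have hcomp : ∀ i ≤ reflectionLength w, i ≠ s + 1 →
      chainElement (insert y (F.erase m)) i = chainElement F i := by
    intro i hi his
    refine chainElement_eq_of_mem hH (Finset.mem_insert_of_mem (Finset.mem_erase.2 ⟨?_, ?_⟩))
      (reflectionLength_chainElement hF hi)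
    · intro e
      have := reflectionLength_chainElement hF hi
      rw [e, hlm] at this
      exact his this.symm
    · exact chainElement_mem hF hi
  have hcy : chainElement (insert y (F.erase m)) (s + 1) = y :=
    chainElement_eq_of_mem hH (Finset.mem_insert_self _ _) hly
  have hms : chainStep F s ≠ firstSwap v := by
    intro e
    apply hne
    rw [hy, ← e, chainStep, mul_inv_cancel_left]
  have hHs : chainStep (insert y (F.erase m)) s = firstSwap v := by
    rw [chainStep, hcomp s (by omega) (by omega), hcy, ← hx, hy, inv_mul_cancel_left]
  refine ⟨insert y (F.erase m), hH, ?_, Finset.subset_insert _ _, ?_⟩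
  · refine ⟨⟨s, by omega⟩, fun j hj => ?_, ?_⟩
    · have hj' : j.1 < s := hj
      change swapLabel w (chainStep _ _) = swapLabel w (chainStep _ _)
      rw [chainStep, chainStep, hcomp _ (by omega) (by omega), hcomp _ (by omega) (by omega)]
    · change swapLabel w (chainStep _ s) < swapLabel w (chainStep F s)
      rw [hHs]
      have hvw : v ≤ w := (inv_mul_absolute_le hxz).trans hzw
      have hsv : chainStep F s ≤ v := chainStep_le_of_le hF (by omega) (by omega)
      have hsl := reflectionLength_chainStep hF (i := s) (by omega)
      refine lt_of_le_of_ne (swapLabel_firstSwap_le hsv hvw hsl) fun e => hms ?_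
      exact (swapLabel_injective (hfv.trans hvw) (hsv.trans hvw) hlf hsl e).symm
  · intro h
    rcases Finset.mem_insert.1 h with h | h
    · exact hne h
    · exact Finset.notMem_erase _ _ h

/-- Where a maximal chain differs from a lexicographically smaller one, some step is not the first
one of its rank two interval. -/
theorem exists_not_firstSwap {G : Finset (Equiv.Perm (Fin n))} (hF : F ∈ maximalChains w)
    (hG : G ∈ maximalChains w) (hlt : chainKey w G < chainKey w F) :
    ∃ r, 0 < r ∧ r < reflectionLength w ∧ chainElement F r ∉ G ∧
      chainElement F r ≠ chainElement F (r - 1) *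
        firstSwap ((chainElement F (r - 1))⁻¹ * chainElement F (r + 1)) := by
  classical
  obtain ⟨⟨p, hp⟩, hagree, hless⟩ := hlt
  replace hless : swapLabel w (chainStep G p) < swapLabel w (chainStep F p) := hless
  have heq := chainElement_eq_of_labels hG hF hp.le fun i hi => hagree ⟨i, hi.trans hp⟩ hi
  have hex : ∃ q, p < q ∧ chainElement F q = chainElement G q :=
    ⟨_, hp, by rw [chainElement_top hF, chainElement_top hG]⟩
  set q := Nat.find hex
  obtain ⟨hpq, hq⟩ : p < q ∧ chainElement F q = chainElement G q := Nat.find_spec hex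
  have hqw : q ≤ reflectionLength w :=
    Nat.find_min' hex ⟨hp, by rw [chainElement_top hF, chainElement_top hG]⟩
  by_contra! hc
  have hfirst := eq_mul_firstSwap_of_forall (f := chainElement F) (d := reflectionLength w)
    (fun i j hij hj => chainElement_le hF hij hj)
    (fun i hi => reflectionLength_chainElement hF hi) hpq hqw (fun r h1 h2 => by
      refine hc r (by omega) (by omega) fun hmem => Nat.find_min hex h2 ⟨h1, ?_⟩
      exact (chainElement_eq_of_mem hG hmem
        (reflectionLength_chainElement hF (by omega))).symm)
  have hstep : chainStep F p = firstSwap ((chainElement F p)⁻¹ * chainElement F q) := by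
    rw [chainStep, hfirst, inv_mul_cancel_left]
  have hle := swapLabel_firstSwap_le (w := w) (chainStep_le_of_le hG hpq hqw)
    (inv_chainElement_mul_le hG hpq.le hqw) (reflectionLength_chainStep hG hp)
  rw [← hq, heq p le_rfl, ← hstep] at hle
  exact absurd hless (not_lt.2 hle)

end chainElement

theorem exists_mem_maximalChains {n : ℕ} (w : Equiv.Perm (Fin n)) : ∃ F, F ∈ maximalChains w := by
  obtain ⟨F, hF, -⟩ := exists_maximalChains_superset (w := w) (F := ∅) ⟨by simp, by simp⟩
  exact ⟨F, hF⟩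

theorem hasRank_Iic {n : ℕ} (w : Equiv.Perm (Fin n)) :
    HasRank (Set.Iic w) (reflectionLength w : ℤ) := by
  obtain ⟨F, hF⟩ := exists_mem_maximalChains w
  refine ⟨⟨F, hF.1, by have := hF.2; omega⟩, fun G hG => ?_⟩
  have := card_le_of_mem_orderComplex_Iic hG
  omega

/-- Intervals of the absolute order are lexicographically shellable. -/
theorem isPureShellable_Iic {n : ℕ} (w : Equiv.Perm (Fin n)) :
    IsPureShellable (orderComplex (Set.Iic w)) := by
  classical
  have hfac := complexFacets_orderComplex_Iic w
  refine isPureShellable_of_key (d := reflectionLength w) (Set.toFinite _) ?_ ?_ ?_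
    (chainKey w) (hfac ▸ chainKey_injOn) ?_
  · obtain ⟨F, hF⟩ := exists_mem_maximalChains w
    exact ⟨F, hF.1, hF.2⟩
  · exact fun F hF => card_le_of_mem_orderComplex_Iic hF
  · rw [hfac]; exact fun F hF => hF.2
  · rw [hfac]
    intro F hF G hG hlt
    obtain ⟨r, h0, hr, hrG, hne⟩ := exists_not_firstSwap hF hG hlt
    obtain ⟨H, hH, hkey, hsub, hrH⟩ := exists_smaller_maximalChains hF h0 hr hne
    have hmem := chainElement_mem hF hr.le
    refine ⟨H, hH, hkey, fun x hx => ?_, ?_⟩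
    · obtain ⟨h1, h2⟩ := Finset.mem_inter.1 hx
      exact hsub (Finset.mem_erase.2 ⟨fun e => hrG (e ▸ h1), h2⟩)
    · have : H ∩ F = F.erase (chainElement F r) := by
        ext x
        rw [Finset.mem_inter, Finset.mem_erase]
        constructor
        · rintro ⟨h1, h2⟩; exact ⟨fun e => hrH (e ▸ h1), h2⟩
        · rintro ⟨h1, h2⟩; exact ⟨hsub (Finset.mem_erase.2 ⟨h1, h2⟩), h2⟩
      rw [this, Finset.card_erase_of_mem hmem, hF.2]; rfl

theorem isStronglyConstructible_Iic {n : ℕ} (w : Equiv.Perm (Fin n)) :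
    IsStronglyConstructible (Set.Iic w) :=
  .bounded _ (Set.toFinite _) ⟨1, absolute_one_le w, fun _ _ => absolute_one_le _⟩
    ⟨w, Set.mem_Iic.2 le_rfl, fun _ h => h⟩ (isPureShellable_Iic w)

/-! ### Unions of strongly constructible ideals -/

section Unions

variable {P ι : Type*}

theorem biUnion_insert_eq_union (A : ι → Set P) (a : ι) (s : Finset ι) [DecidableEq ι] :
    (⋃ i ∈ insert a s, A i) = (⋃ i ∈ s, A i) ∪ A a := by
  rw [Finset.set_biUnion_insert, Set.union_comm]

theorem biUnion_inter_const (A : ι → Set P) (B : Set P) (s : Finset ι) :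
    (⋃ i ∈ s, A i) ∩ B = ⋃ i ∈ s, A i ∩ B := by
  simp only [Set.iUnion_inter]

theorem biInter_inter_const (A : ι → Set P) (a : ι) {T : Finset ι} [DecidableEq ι]
    (hT : T.Nonempty) : (⋂ i ∈ T, A i ∩ A a) = ⋂ i ∈ insert a T, A i := by
  ext x
  simp only [Set.mem_iInter, Set.mem_inter_iff, Finset.mem_insert, forall_eq_or_imp]
  constructor
  · intro h
    obtain ⟨i, hi⟩ := hT
    exact ⟨(h i hi).2, fun j hj => (h j hj).1⟩
  · exact fun h i hi => ⟨h.2 i hi, h.1⟩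

variable [PartialOrder P]

theorem IsStronglyConstructible.exists_isLeast {s : Set P} (h : IsStronglyConstructible s) :
    ∃ a, IsLeast s a := by
  cases h <;> assumption

theorem IsStronglyConstructible.finite {s : Set P} (h : IsStronglyConstructible s) :
    s.Finite := by
  cases h <;> assumption

/-- `s` is an order ideal of `P` that is strongly constructible of rank `d`. -/
structure IsConstructibleIdeal (s : Set P) (d : ℤ) : Prop where
  isLowerSet : IsLowerSet s
  isStronglyConstructible : IsStronglyConstructible s
  hasRank : HasRank s d

theorem mem_orderComplex_or_of_union {A B : Set P} (hA : IsLowerSet A) (hB : IsLowerSet B)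
    {F : Finset P} (hF : F ∈ orderComplex (A ∪ B)) :
    F ∈ orderComplex A ∨ F ∈ orderComplex B := by
  rcases F.eq_empty_or_nonempty with rfl | hne
  · exact Or.inl ⟨by simp, by simp⟩
  obtain ⟨m, hm, hmax⟩ := F.exists_maximal hne
  have htop : ∀ x ∈ F, x ≤ m := fun x hx => (hF.2.total hx hm).elim id fun h => hmax hx h
  rcases hF.1 hm with h | h
  · exact Or.inl ⟨fun x hx => hA (htop x hx) h, hF.2⟩
  · exact Or.inr ⟨fun x hx => hB (htop x hx) h, hF.2⟩

theorem hasRank_union {A B : Set P} (hA : IsLowerSet A) (hB : IsLowerSet B) {d : ℤ}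
    (h1 : HasRank A d) (h2 : HasRank B d) : HasRank (A ∪ B) d := by
  obtain ⟨⟨F, hF, hc⟩, hle⟩ := h1
  refine ⟨⟨F, ⟨hF.1.trans Set.subset_union_left, hF.2⟩, hc⟩, fun G hG => ?_⟩
  rcases mem_orderComplex_or_of_union hA hB hG with h | h
  · exact hle G h
  · exact h2.2 G h

theorem IsConstructibleIdeal.union {A B : Set P} {d e : ℤ} (hA : IsConstructibleIdeal A d)
    (hB : IsConstructibleIdeal B d) (hAB : IsConstructibleIdeal (A ∩ B) e) (hde : d - 1 ≤ e) :
    IsConstructibleIdeal (A ∪ B) d := by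
  by_cases h1 : A ⊆ B
  · rwa [Set.union_eq_right.2 h1]
  by_cases h2 : B ⊆ A
  · rwa [Set.union_eq_left.2 h2]
  have hrank := hasRank_union hA.isLowerSet hB.isLowerSet hA.hasRank hB.hasRank
  refine ⟨hA.isLowerSet.union hB.isLowerSet, ?_, hrank⟩
  refine .union _ A B d e (hA.isStronglyConstructible.finite.union
    hB.isStronglyConstructible.finite) ?_ hrank rfl ⟨Set.subset_union_left, ?_⟩
    ⟨Set.subset_union_right, ?_⟩ ?_ ?_ hA.hasRank hB.hasRank hAB.hasRank hde
    hA.isStronglyConstructible hB.isStronglyConstructible hAB.isStronglyConstructible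
  · obtain ⟨a, ha⟩ := hA.isStronglyConstructible.exists_isLeast
    obtain ⟨b, hb⟩ := hB.isStronglyConstructible.exists_isLeast
    obtain ⟨c, hc, -⟩ := hAB.isStronglyConstructible.exists_isLeast
    refine ⟨a, Or.inl ha.1, ?_⟩
    have haB : a ∈ B := hB.isLowerSet (ha.2 hc.1) hc.2
    have hbA : b ∈ A := hA.isLowerSet (hb.2 hc.2) hc.1
    rintro x (hx | hx)
    · exact ha.2 hx
    · exact (ha.2 hbA).trans (hb.2 hx)
  · exact fun x _ y hy hxy => hA.isLowerSet hxy hy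
  · exact fun x _ y hy hxy => hB.isLowerSet hxy hy
  · intro e; exact h2 (Set.union_eq_left.1 e.symm)
  · intro e; exact h1 (Set.union_eq_right.1 e.symm)

/-- The union of a family of ideals all of whose intersections are strongly constructible of one
and the same rank. -/
theorem IsConstructibleIdeal.biUnion_of_forall {d : ℤ} (A : ι → Set P) (s : Finset ι)
    (hs : s.Nonempty)
    (h : ∀ T ⊆ s, T.Nonempty → IsConstructibleIdeal (⋂ i ∈ T, A i) d) :
    IsConstructibleIdeal (⋃ i ∈ s, A i) d := by
  classical
  induction hs using Finset.Nonempty.cons_induction generalizing A with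
  | singleton a => simpa using h {a} subset_rfl (by simp)
  | cons a s ha hs ih =>
    rw [Finset.cons_eq_insert] at h ⊢
    have h1 := ih A fun T hT => h T (hT.trans (Finset.subset_insert _ _))
    have h2 := ih (fun i => A i ∩ A a) fun T hT hne => by
      rw [biInter_inter_const A a hne]
      exact h _ (Finset.insert_subset_insert _ hT) (Finset.insert_nonempty _ _)
    rw [← biUnion_inter_const] at h2
    rw [biUnion_insert_eq_union]
    have h3 : IsConstructibleIdeal (A a) d := by simpa using h {a} (by simp) (by simp)
    exact h1.union h3 h2 (by omega)

/-- The union of a family of ideals of rank `d` such that the intersections of two or more of them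
are strongly constructible of rank `d - 1`. -/
theorem IsConstructibleIdeal.biUnion {d : ℤ} (A : ι → Set P) (s : Finset ι) (hs : s.Nonempty)
    (h : ∀ i ∈ s, IsConstructibleIdeal (A i) d)
    (h2 : ∀ T ⊆ s, 2 ≤ T.card → IsConstructibleIdeal (⋂ i ∈ T, A i) (d - 1)) :
    IsConstructibleIdeal (⋃ i ∈ s, A i) d := by
  classical
  induction hs using Finset.Nonempty.cons_induction with
  | singleton a => simpa using h a (by simp)
  | cons a s ha hs ih =>
    rw [Finset.cons_eq_insert] at h h2 ⊢
    have h1 := ih (fun i hi => h i (Finset.mem_insert_of_mem hi))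
      fun T hT => h2 T (hT.trans (Finset.subset_insert _ _))
    have h3 := biUnion_of_forall (d := d - 1) (fun i => A i ∩ A a) s hs fun T hT hne => by
      rw [biInter_inter_const A a hne]
      refine h2 _ (Finset.insert_subset_insert _ hT) ?_
      rw [Finset.card_insert_of_notMem fun hc => ha (hT hc)]
      have := hne.card_pos
      omega
    rw [← biUnion_inter_const] at h3
    rw [biUnion_insert_eq_union]
    exact h1.union (h a (Finset.mem_insert_self _ _)) h3 le_rfl

/-- The union of a central ideal `B` and further ideals that pairwise meet inside `B`. -/
theorem IsConstructibleIdeal.union_biUnion {d : ℤ} (B : Set P) (A : ι → Set P) (s : Finset ι)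
    (hB : IsConstructibleIdeal B d) (hA : ∀ i ∈ s, IsConstructibleIdeal (A i) d)
    (hBA : ∀ i ∈ s, IsConstructibleIdeal (B ∩ A i) (d - 1))
    (hAA : ∀ i ∈ s, ∀ j ∈ s, i ≠ j → A i ∩ A j ⊆ B) :
    IsConstructibleIdeal (B ∪ ⋃ i ∈ s, A i) d := by
  classical
  induction s using Finset.induction_on with
  | empty => simpa using hB
  | insert a s ha ih =>
    have h1 := ih (fun i hi => hA i (Finset.mem_insert_of_mem hi))
      (fun i hi => hBA i (Finset.mem_insert_of_mem hi))
      fun i hi j hj => hAA i (Finset.mem_insert_of_mem hi) j (Finset.mem_insert_of_mem hj)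
    have h2 : (B ∪ ⋃ i ∈ s, A i) ∩ A a = B ∩ A a := by
      refine Set.Subset.antisymm ?_ (Set.inter_subset_inter_left _ Set.subset_union_left)
      rintro x ⟨hx | hx, hxa⟩
      · exact ⟨hx, hxa⟩
      · obtain ⟨i, hi, hxi⟩ := Set.mem_iUnion₂.1 hx
        exact ⟨hAA i (Finset.mem_insert_of_mem hi) a (Finset.mem_insert_self _ _)
          (fun e => ha (e ▸ hi)) ⟨hxi, hxa⟩, hxa⟩
    rw [biUnion_insert_eq_union, ← Set.union_assoc]
    refine h1.union (hA a (Finset.mem_insert_self _ _)) (e := d - 1) ?_ le_rfl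
    rw [h2]
    exact hBA a (Finset.mem_insert_self _ _)

end Unions

/-! ### Sequences that are consecutive in a cycle -/

/-- `L` appears consecutively in a cycle of `w`: each of its entries but the last is mapped by `w`
to the next one. -/
def Follows {n : ℕ} (w : Equiv.Perm (Fin n)) (L : List (Fin n)) : Prop :=
  L.IsChain (fun x y => w x = y)

section Follows

variable {n : ℕ} {u w w' : Equiv.Perm (Fin n)} {L s : List (Fin n)} {a b t : Fin n}

theorem Follows.nil : Follows w [] := List.IsChain.nil

theorem Follows.singleton (x : Fin n) : Follows w [x] := List.IsChain.singleton x

theorem Follows.left_of_append {M : List (Fin n)} (h : Follows w (L ++ M)) : Follows w L :=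
  List.IsChain.left_of_append h

theorem follows_concat_iff :
    Follows w (s ++ [a] ++ [b]) ↔ Follows w (s ++ [a]) ∧ w a = b := by
  rw [Follows, Follows, List.append_assoc, List.singleton_append,
    List.isChain_append_cons_cons]
  simp

theorem Follows.congr (h : Follows w L) (H : ∀ x ∈ L, w x ∈ L → w' x = w x) : Follows w' L :=
  List.IsChain.imp_of_mem_imp (fun x y hx hy e => by subst e; exact H x hx hy) h

theorem Follows.congr_of_dropLast (h : Follows w (s ++ [a])) (H : ∀ x ∈ s, w' x = w x) :
    Follows w' (s ++ [a]) := by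
  rw [Follows, List.isChain_iff_getElem] at h ⊢
  intro i hi
  have hi' : i < s.length := by simpa using hi
  rw [← h i hi]
  apply H
  rw [List.getElem_append_left hi']
  exact List.getElem_mem _

theorem Follows.sameCycle (h : Follows w L) {x y : Fin n} (hx : x ∈ L) (hy : y ∈ L) :
    w.SameCycle x y := by
  suffices H : ∀ (L : List (Fin n)) (z : Fin n), Follows w (z :: L) →
      ∀ y ∈ z :: L, w.SameCycle z y by
    cases L with
    | nil => simp at hx
    | cons z L => exact (H L z h x hx).symm.trans (H L z h y hy)
  intro L
  induction L with
  | nil => intro z _ y hy; rw [List.mem_singleton.1 hy]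
  | cons c L ih =>
    intro z h y hy
    rcases List.mem_cons.1 hy with rfl | hy
    · exact Equiv.Perm.SameCycle.refl _ _
    · have h' := List.isChain_cons_cons.1 h
      exact Equiv.Perm.SameCycle.trans ⟨1, by simpa using h'.1⟩ (ih c h'.2 y hy)

theorem mem_of_sameCycle_of_forall {S : Set (Fin n)} (hS : ∀ x ∈ S, w x ∈ S) {x y : Fin n}
    (hx : x ∈ S) (h : w.SameCycle x y) : y ∈ S := by
  obtain ⟨m, rfl⟩ := h.exists_nat_pow_eq
  clear h
  induction m with
  | zero => exact hx
  | succ m ih => rw [pow_succ', Equiv.Perm.mul_apply]; exact hS _ ih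

open Equiv in
/-- If `L` is followed by `t` in the cycle of `w`, and the cycle of `t` in some `u ≤ w` meets `L`,
then it does so in the point that `u` maps to `t`: otherwise `t` could be cut off from `L`. -/
theorem symm_apply_mem_of_follows (h : u ≤ w) (hf : Follows w (L ++ [t]))
    (hnd : (L ++ [t]).Nodup) {y : Fin n} (hy : y ∈ L) (hty : u.SameCycle t y) :
    u.symm t ∈ L := by
  obtain ⟨s, a, rfl⟩ := List.eq_nil_or_concat' L |>.resolve_left (List.ne_nil_of_mem hy)
  rw [follows_concat_iff] at hf
  obtain ⟨hf, hat⟩ := hf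
  by_contra hc
  set c := u.symm t with hcdef
  have hct : u c = t := by simp [c]
  have hca : c ≠ a := fun e => hc (by simp [e])
  obtain ⟨h1, h2, -⟩ := absolute_le_mul_swap_of_apply_eq h hca (hct.trans hat.symm)
  have hwt : (w * swap c a) c = t := by simp [hat]
  have hf' : Follows (w * swap c a) (s ++ [a]) := by
    refine hf.congr_of_dropLast fun x hx => ?_
    have hxc : x ≠ c := fun e => hc (by simp [← e, hx])
    have hxa : x ≠ a := by
      rintro rfl
      have := (List.nodup_append.1 (List.nodup_append.1 hnd).1).2.2 x hx x (by simp)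
      exact this rfl
    rw [Perm.mul_apply, swap_apply_of_ne_of_ne hxc hxa]
  have hcw : w.SameCycle c a := by
    have h3 : w.SameCycle c t := sameCycle_of_absolute_le h ⟨1, by simp [hct]⟩
    exact h3.trans (Perm.SameCycle.symm ⟨1, by simp [hat]⟩)
  apply not_sameCycle_mul_swap hca hcw
  have h3 : (w * swap c a).SameCycle c t := ⟨1, by simpa using hwt⟩
  exact (h3.trans (sameCycle_of_absolute_le h1 hty)).trans (hf'.sameCycle hy (by simp))

open Equiv in
/-- If `L` is followed by `t` in the cycle of `w` and `u ≤ w` maps some point of `L` to `t`, then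
`u` maps all later points of `L` into `L`. -/
theorem apply_mem_of_follows (h : u ≤ w) (hf : Follows w (L ++ [t])) (hnd : L.Nodup)
    {j k : ℕ} (hjk : j < k) (hk : k < L.length) (hj : u (L[j]'(hjk.trans hk)) = t) :
    u L[k] ∈ L := by
  obtain ⟨s, a, rfl⟩ := List.eq_nil_or_concat' L |>.resolve_left (by rintro rfl; simp at hk)
  rw [follows_concat_iff] at hf
  obtain ⟨hf, hat⟩ := hf
  set L := s ++ [a] with hL
  have hlen : L.length = s.length + 1 := by simp [hL]
  have hlast : L[s.length] = a := by simp [hL]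
  have hinj : ∀ {p q : ℕ} (hp : p < L.length) (hq : q < L.length), L[p] = L[q] → p = q :=
    fun hp hq e => (List.Nodup.getElem_inj_iff hnd).1 e
  rw [Follows, List.isChain_iff_getElem] at hf
  set c := L[j] with hc
  have hca : c ≠ a := by
    intro e
    have := hinj (p := j) (q := s.length) (by omega) (by omega) (by rw [hlast, ← hc, e])
    omega
  obtain ⟨h1, -, -⟩ := absolute_le_mul_swap_of_apply_eq h hca (hj.trans hat.symm)
  -- The points of `L` after `c` form a union of cycles of `w * swap c a`.
  let Z : Set (Fin n) := {x | ∃ (p : ℕ) (hp : p < L.length), j < p ∧ L[p] = x}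
  have hZ : ∀ x ∈ Z, (w * swap c a) x ∈ Z := by
    rintro x ⟨p, hp, hjp, rfl⟩
    by_cases hps : p = s.length
    · subst hps
      refine ⟨j + 1, by omega, by omega, ?_⟩
      rw [hlast, Perm.mul_apply, swap_apply_right, hc, hf j (by omega)]
    · refine ⟨p + 1, by omega, by omega, ?_⟩
      have e1 : L[p] ≠ c := fun e => by
        have := hinj (p := p) (q := j) hp (by omega) e
        omega
      have e2 : L[p] ≠ a := fun e => by
        have := hinj (p := p) (q := s.length) hp (by omega) (by rw [hlast, e])
        omega
      rw [Perm.mul_apply, swap_apply_of_ne_of_ne e1 e2, hf p (by omega)]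
  have hmem : L[k] ∈ Z := ⟨k, hk, hjk, rfl⟩
  have hsc : (w * swap c a).SameCycle L[k] (u L[k]) :=
    sameCycle_of_absolute_le h1 ⟨1, by simp⟩
  obtain ⟨p, hp, -, e⟩ := mem_of_sameCycle_of_forall hZ hmem hsc
  rw [← e]
  exact List.getElem_mem _

/-- Among the possible continuations `t` of `L` in permutations above `u`, at most one lies in
a cycle of `u` that meets `L`: it is the image of the last point of `L` that `u` maps out
of `L`. -/
theorem eq_of_follows_of_sameCycle {t' : Fin n} (h : u ≤ w) (h' : u ≤ w')
    (hf : Follows w (L ++ [t])) (hf' : Follows w' (L ++ [t'])) (hnd : (L ++ [t]).Nodup)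
    (hnd' : (L ++ [t']).Nodup) {y y' : Fin n} (hy : y ∈ L) (hy' : y' ∈ L)
    (hty : u.SameCycle t y) (hty' : u.SameCycle t' y') : t = t' := by
  have hL : L.Nodup := (List.nodup_append.1 hnd).1
  have htL : t ∉ L := fun h => (List.nodup_append.1 hnd).2.2 t h t (by simp) rfl
  have htL' : t' ∉ L := fun h => (List.nodup_append.1 hnd').2.2 t' h t' (by simp) rfl
  obtain ⟨j, hj, e⟩ := List.getElem_of_mem (symm_apply_mem_of_follows h hf hnd hy hty)
  obtain ⟨k, hk, e'⟩ := List.getElem_of_mem (symm_apply_mem_of_follows h' hf' hnd' hy' hty')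
  have hjt : u L[j] = t := by rw [e]; simp
  have hkt : u L[k] = t' := by rw [e']; simp
  rcases lt_trichotomy j k with hlt | rfl | hlt
  · exact absurd (hkt ▸ apply_mem_of_follows h hf hL hlt hk hjt) htL'
  · rw [← hjt, hkt]
  · exact absurd (hjt ▸ apply_mem_of_follows h' hf' hL hlt hj hkt) htL

end Follows

/-! ### Ideals of permutations with labelled cycles -/

/-- The cycles of `w` can be labelled by `f` in such a way that every point `x` gets a label allowed
by `g x`, and the sequences `σ l` are consecutive in cycles of `w`. Several cycles may have the same
label. -/
structure IsLabelled {n : ℕ} {ι : Type*} (σ : ι → List (Fin n)) (g : Fin n → Set ι)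
    (w : Equiv.Perm (Fin n)) (f : Fin n → ι) : Prop where
  follows : ∀ l, Follows w (σ l)
  apply_eq : ∀ x, f (w x) = f x
  mem : ∀ x, f x ∈ g x

/-- The permutations that lie below some permutation whose cycles can be labelled. -/
def labelledIdeal {n : ℕ} {ι : Type*} (σ : ι → List (Fin n)) (g : Fin n → Set ι) :
    Set (Equiv.Perm (Fin n)) :=
  {u | ∃ w f, u ≤ w ∧ IsLabelled σ g w f}

/-- The constraints are consistent: the points of `σ l` must have the label `l`, every point is
allowed some label, and every label is forced upon some point. -/
structure IsConsistent {n : ℕ} {ι : Type*} (σ : ι → List (Fin n)) (g : Fin n → Set ι) :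
    Prop where
  nodup : ∀ l, (σ l).Nodup
  eq_singleton : ∀ l, ∀ x ∈ σ l, g x = {l}
  nonempty : ∀ x, (g x).Nonempty
  exists_eq_singleton : ∀ l, ∃ x, g x = {l}

theorem IsConsistent.card_le {n : ℕ} {ι : Type*} {σ : ι → List (Fin n)} {g : Fin n → Set ι}
    (h : IsConsistent σ g) : Nat.card ι ≤ n := by
  choose x hx using h.exists_eq_singleton
  have := Nat.card_le_card_of_injective x fun l m e => by
    have h1 := hx l
    rw [e, hx m] at h1
    exact (Set.singleton_injective h1).symm
  rwa [Nat.card_fin] at this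

/-- The set of points in the same cycle of `u` as some point of `T`. -/
def cyclesMeeting {n : ℕ} (u : Equiv.Perm (Fin n)) (T : Set (Fin n)) : Set (Fin n) :=
  {y | ∃ t ∈ T, u.SameCycle t y}

theorem apply_mem_cyclesMeeting {n : ℕ} {u : Equiv.Perm (Fin n)} {T : Set (Fin n)} (x : Fin n) :
    u x ∈ cyclesMeeting u T ↔ x ∈ cyclesMeeting u T := by
  simp only [cyclesMeeting, Set.mem_ofPred_eq, Equiv.Perm.sameCycle_apply_right]

theorem mem_cyclesMeeting {n : ℕ} {u : Equiv.Perm (Fin n)} {T : Set (Fin n)} {x : Fin n}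
    (hx : x ∈ T) : x ∈ cyclesMeeting u T :=
  ⟨x, hx, Equiv.Perm.SameCycle.refl _ _⟩

theorem apply_eq_of_sameCycle_of_le {n : ℕ} {β : Type*} {u w : Equiv.Perm (Fin n)} (h : u ≤ w)
    {f : Fin n → β} (hf : ∀ x, f (w x) = f x) {x y : Fin n} (hxy : u.SameCycle x y) :
    f x = f y :=
  apply_eq_of_sameCycle hf (sameCycle_of_absolute_le h hxy)

/-- Detaching: given `u ≤ w`, the cycles of `u` that meet `T` can be given the label `c` of their
own, provided that they contain no point of the prescribed sequences. -/
theorem mem_labelledIdeal_of_detach {n : ℕ} {β κ : Type*} {u w : Equiv.Perm (Fin n)} (h : u ≤ w)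
    {f : Fin n → β} (hf : ∀ x, f (w x) = f x) (T : Set (Fin n)) {σ : κ → List (Fin n)}
    {g : Fin n → Set κ} (hσ : ∀ l, Follows w (σ l))
    (hdisj : ∀ l, ∀ x ∈ σ l, x ∉ cyclesMeeting u T) (F : β → κ) (c : κ)
    (hc : ∀ x ∈ cyclesMeeting u T, c ∈ g x) (hF : ∀ x, x ∉ cyclesMeeting u T → F (f x) ∈ g x) :
    u ∈ labelledIdeal σ g := by
  classical
  obtain ⟨w', h1, h2, h3, h4⟩ :=
    exists_absolute_le_invariant h (cyclesMeeting u T) apply_mem_cyclesMeeting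
  refine ⟨w', fun x => if x ∈ cyclesMeeting u T then c else F (f x), h1,
    fun l => (hσ l).congr fun x hx hwx => h4 x (hdisj l x hx) (hdisj l _ hwx), fun x => ?_,
    fun x => ?_⟩
  · simp only [h3, apply_eq_of_absolute_le h2 hf]
  · split_ifs with hx
    · exact hc x hx
    · exact hF x hx

open Equiv in
/-- Inserting: if the cycle of `b` in `w` contains no point of the prescribed sequences, it can be
merged with another cycle in such a way that `b` follows the last point of a prescribed sequence. -/
theorem mem_labelledIdeal_of_insert {n : ℕ} {κ : Type*} {u w : Equiv.Perm (Fin n)} (h : u ≤ w)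
    {σ : κ → List (Fin n)} {g : Fin n → Set κ} {f : Fin n → κ} (hf : ∀ x, f (w x) = f x)
    (hg : ∀ x, f x ∈ g x) {j : κ} {s : List (Fin n)} {a b : Fin n} (hj : σ j = s ++ [a] ++ [b])
    (hjw : Follows w (s ++ [a])) (hnd : (s ++ [a]).Nodup)
    (hjb : ¬ w.SameCycle a b) (hfab : f a = f b)
    (hσ : ∀ l, l ≠ j → Follows w (σ l) ∧ ∀ x ∈ σ l, x ≠ a ∧ ¬ w.SameCycle x b) :
    u ∈ labelledIdeal σ g := by
  set c := w.symm b with hc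
  have hwc : w c = b := by simp [hc]
  have hcb : w.SameCycle c b := ⟨1, by simp [hwc]⟩
  have hac : ¬ w.SameCycle a c := fun hs => hjb (hs.trans hcb)
  have hfac : f a = f c := by rw [hfab, ← hwc, hf]
  refine ⟨w * swap a c, f, h.trans (absolute_le_mul_swap hac), fun l => ?_, fun x => ?_, hg⟩
  · by_cases hl : l = j
    · subst hl
      rw [hj, follows_concat_iff]
      refine ⟨hjw.congr_of_dropLast fun x hx => ?_, by simp [hwc]⟩
      have hxa : x ≠ a := fun e => (List.nodup_append.1 hnd).2.2 x hx a (by simp) e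
      have hxc : x ≠ c := fun e => hac (e ▸ hjw.sameCycle (by simp) (by simp [hx]))
      rw [Perm.mul_apply, swap_apply_of_ne_of_ne hxa hxc]
    · obtain ⟨h1, h2⟩ := hσ l hl
      refine h1.congr fun x hx _ => ?_
      obtain ⟨h3, h4⟩ := h2 x hx
      rw [Perm.mul_apply, swap_apply_of_ne_of_ne h3 fun e => h4 (e ▸ hcb)]
  · rw [Perm.mul_apply, hf]
    by_cases hxa : x = a
    · rw [hxa, swap_apply_left, hfac]
    by_cases hxc : x = c
    · rw [hxc, swap_apply_right, hfac]
    · rw [swap_apply_of_ne_of_ne hxa hxc]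

/-! ### Resolving a point with several allowed labels -/

/-- The family `σ` extended by an empty sequence for a new label `none`. -/
def addLabel {n : ℕ} {ι : Type*} (σ : ι → List (Fin n)) : Option ι → List (Fin n) :=
  fun o => o.elim [] σ

theorem follows_addLabel {n : ℕ} {ι : Type*} {σ : ι → List (Fin n)} {w : Equiv.Perm (Fin n)} :
    (∀ o, Follows w (addLabel σ o)) ↔ ∀ l, Follows w (σ l) := by
  constructor
  · exact fun h l => h (some l)
  · rintro h (_ | l)
    · exact Follows.nil
    · exact h l

theorem mem_addLabel {n : ℕ} {ι : Type*} {σ : ι → List (Fin n)} {x : Fin n} {o : Option ι}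
    (h : x ∈ addLabel σ o) : ∃ l, o = some l ∧ x ∈ σ l := by
  cases o with
  | none => simp [addLabel] at h
  | some l => exact ⟨l, rfl, h⟩

/-- The constraints for the common part of the ideals in which `x` is given a label from `T`: the
point `x` gets a new label, which is also allowed for all points that admit every label in `T`. -/
def splitLabels {n : ℕ} {ι : Type*} (g : Fin n → Set ι) (x : Fin n) (T : Set ι) (y : Fin n) :
    Set (Option ι) :=
  {o | (y = x → o = none) ∧ (y ≠ x → o.elim (T ⊆ g y) (· ∈ g y))}

section Split

variable {n : ℕ} {ι : Type*} {σ : ι → List (Fin n)} {g : Fin n → Set ι} {x : Fin n}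

theorem splitLabels_self (T : Set ι) : splitLabels g x T x = {none} := by
  ext o; simp [splitLabels]

theorem splitLabels_of_eq_singleton {T : Set ι} (hT : T.Nontrivial) (hx : ¬ (g x).Subsingleton)
    {y : Fin n} {l : ι} (hy : g y = {l}) : splitLabels g x T y = {some l} := by
  have hyx : y ≠ x := by rintro rfl; rw [hy] at hx; exact hx Set.subsingleton_singleton
  ext o
  cases o with
  | none =>
    have : ¬ T ⊆ {l} := fun h => Set.not_subsingleton_iff.2 hT
      (Set.subsingleton_singleton.anti h)
    simp [splitLabels, hyx, hy, this]
  | some m => simp [splitLabels, hyx, hy]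

theorem IsConsistent.splitLabels (h : IsConsistent σ g) {T : Set ι} (hT : T.Nontrivial)
    (hx : ¬ (g x).Subsingleton) : IsConsistent (addLabel σ) (splitLabels g x T) where
  nodup := by
    rintro (_ | l)
    · exact List.nodup_nil
    · exact h.nodup l
  eq_singleton := by
    rintro o y hy
    obtain ⟨l, rfl, hyl⟩ := mem_addLabel hy
    exact splitLabels_of_eq_singleton hT hx (h.eq_singleton l y hyl)
  nonempty := by
    intro y
    by_cases hyx : y = x
    · subst hyx; rw [splitLabels_self]; exact Set.singleton_nonempty _
    · obtain ⟨l, hl⟩ := h.nonempty y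
      exact ⟨some l, fun e => absurd e hyx, fun _ => hl⟩
  exists_eq_singleton := by
    rintro (_ | l)
    · exact ⟨x, splitLabels_self T⟩
    · obtain ⟨y, hy⟩ := h.exists_eq_singleton l
      exact ⟨y, splitLabels_of_eq_singleton hT hx hy⟩

theorem IsConsistent.update_label (h : IsConsistent σ g) (hx : ¬ (g x).Subsingleton) (i : ι) :
    IsConsistent σ (Function.update g x {i}) := by
  have key : ∀ y l, g y = {l} → Function.update g x {i} y = {l} := by
    intro y l hy
    rw [Function.update_of_ne, hy]
    rintro rfl
    rw [hy] at hx
    exact hx Set.subsingleton_singleton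
  refine ⟨h.nodup, fun l y hy => key y l (h.eq_singleton l y hy), fun y => ?_, fun l => ?_⟩
  · by_cases hyx : y = x
    · subst hyx; simp
    · rw [Function.update_of_ne hyx]; exact h.nonempty y
  · obtain ⟨y, hy⟩ := h.exists_eq_singleton l
    exact ⟨y, key y l hy⟩

theorem labelledIdeal_eq_biUnion_update {s : Finset ι} (hs : (s : Set ι) = g x) :
    labelledIdeal σ g = ⋃ i ∈ s, labelledIdeal σ (Function.update g x {i}) := by
  have hmem : ∀ i, i ∈ s ↔ i ∈ g x := fun i => by rw [← hs, Finset.mem_coe]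
  ext u
  simp only [Set.mem_iUnion, exists_prop]
  constructor
  · rintro ⟨w, f, h, hw⟩
    refine ⟨f x, (hmem _).2 (hw.mem x), w, f, h, hw.follows, hw.apply_eq, fun y => ?_⟩
    by_cases hyx : y = x
    · subst hyx; simp
    · rw [Function.update_of_ne hyx]; exact hw.mem y
  · rintro ⟨i, hi, w, f, h, hw⟩
    refine ⟨w, f, h, hw.follows, hw.apply_eq, fun y => ?_⟩
    have := hw.mem y
    by_cases hyx : y = x
    · subst hyx
      rw [Function.update_self, Set.mem_singleton_iff] at this
      rw [this]; exact (hmem i).1 hi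
    · rwa [Function.update_of_ne hyx] at this

theorem iInter_labelledIdeal_update (hσ : ∀ l, ∀ x ∈ σ l, g x = {l}) {T : Finset ι}
    (hT : (T : Set ι).Nontrivial) (hTx : (T : Set ι) ⊆ g x) :
    ⋂ i ∈ T, labelledIdeal σ (Function.update g x {i}) =
      labelledIdeal (addLabel σ) (splitLabels g x T) := by
  ext u
  simp only [Set.mem_iInter]
  constructor
  · intro hu
    obtain ⟨i, hi⟩ := hT.nonempty
    have hblock : ∀ y ∈ cyclesMeeting u {x}, ∀ j ∈ T, j ∈ g y := by
      rintro y ⟨x', rfl, hy⟩ j hj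
      obtain ⟨w, f, h, hw⟩ := hu j hj
      have h1 := hw.mem x'
      rw [Function.update_self, Set.mem_singleton_iff] at h1
      have h2 := hw.mem y
      rw [← apply_eq_of_sameCycle_of_le h hw.apply_eq hy, h1] at h2
      by_cases hyx : y = x'
      · subst hyx; exact hTx hj
      · rwa [Function.update_of_ne hyx] at h2
    obtain ⟨w, f, h, hw⟩ := hu i hi
    refine mem_labelledIdeal_of_detach h hw.apply_eq {x} (follows_addLabel.2 hw.follows) ?_
      some none ?_ ?_
    · intro o y hy hyD
      obtain ⟨l, rfl, hyl⟩ := mem_addLabel hy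
      have hsub : (T : Set ι) ⊆ {l} := fun j hj => hσ l y hyl ▸ hblock y hyD j hj
      exact Set.not_subsingleton_iff.2 hT (Set.subsingleton_singleton.anti hsub)
    · exact fun y hy => ⟨fun _ => rfl, fun _ => hblock y hy⟩
    · intro y hy
      have hyx : y ≠ x := fun e => hy (mem_cyclesMeeting e)
      have := hw.mem y
      rw [Function.update_of_ne hyx] at this
      exact ⟨fun e => absurd e hyx, fun _ => this⟩
  · rintro ⟨w, f, h, hw⟩ i hi
    refine ⟨w, fun y => (f y).getD i, h, follows_addLabel.1 hw.follows,
      fun y => by rw [hw.apply_eq], fun y => ?_⟩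
    obtain ⟨h1, h2⟩ := hw.mem y
    by_cases hyx : y = x
    · subst hyx; simp [h1 rfl]
    · rw [Function.update_of_ne hyx]
      have h2 := h2 hyx
      cases hfy : f y with
      | none => rw [hfy] at h2; exact h2 hi
      | some l => rw [hfy] at h2; exact h2

end Split

/-! ### Extending a prescribed sequence -/

section Extend

variable {n : ℕ} {ι : Type*} {σ : ι → List (Fin n)} {h : Fin n → ι} {i : ι} {s : List (Fin n)}
  {a : Fin n}

open Classical in
/-- The family `σ` with the point `b` appended to the sequence `σ i`. -/
noncomputable def appendPoint (σ : ι → List (Fin n)) (i : ι) (b : Fin n) : ι → List (Fin n) :=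
  Function.update σ i (σ i ++ [b])

theorem appendPoint_self (b : Fin n) : appendPoint σ i b i = σ i ++ [b] := by
  simp [appendPoint]

theorem appendPoint_of_ne {l : ι} (hl : l ≠ i) (b : Fin n) : appendPoint σ i b l = σ l := by
  simp [appendPoint, hl]

theorem Follows.of_appendPoint {w : Equiv.Perm (Fin n)} {b : Fin n}
    (H : ∀ l, Follows w (appendPoint σ i b l)) (l : ι) : Follows w (σ l) := by
  by_cases hl : l = i
  · subst hl
    have := H l
    rw [appendPoint_self] at this
    exact this.left_of_append
  · simpa [appendPoint_of_ne hl] using H l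

theorem mem_appendPoint {b x : Fin n} {l : ι} (hx : x ∈ appendPoint σ i b l) :
    x ∈ σ l ∨ (l = i ∧ x = b) := by
  by_cases hl : l = i
  · subst hl
    rw [appendPoint_self] at hx
    rcases List.mem_append.1 hx with hx | hx
    · exact Or.inl hx
    · exact Or.inr ⟨rfl, List.mem_singleton.1 hx⟩
  · rw [appendPoint_of_ne hl] at hx
    exact Or.inl hx

theorem nodup_appendPoint (hσ : ∀ l, (σ l).Nodup) {b : Fin n} (hb : b ∉ σ i) (l : ι) :
    (appendPoint σ i b l).Nodup := by
  by_cases hl : l = i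
  · subst hl
    rw [appendPoint_self]
    refine List.nodup_append.2 ⟨hσ l, by simp, ?_⟩
    rintro x hx y hy rfl
    exact hb (List.mem_singleton.1 hy ▸ hx)
  · rw [appendPoint_of_ne hl]; exact hσ l

/-- The points with label `i` that do not belong to the sequence `σ i`. -/
def outside (σ : ι → List (Fin n)) (h : Fin n → ι) (i : ι) : Set (Fin n) :=
  {y | h y = i ∧ y ∉ σ i}

theorem IsConsistent.appendPoint {g : Fin n → Set ι} (hc : IsConsistent σ g) {b : Fin n}
    (hb : b ∉ σ i) (hgb : g b = {i}) : IsConsistent (appendPoint σ i b) g where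
  nodup := nodup_appendPoint hc.nodup hb
  eq_singleton l x hx := by
    rcases mem_appendPoint hx with hx | ⟨rfl, rfl⟩
    · exact hc.eq_singleton l x hx
    · exact hgb
  nonempty := hc.nonempty
  exists_eq_singleton := hc.exists_eq_singleton

theorem label_eq_of_mem (hc : IsConsistent σ fun x => {h x}) {l : ι} {x : Fin n} (hx : x ∈ σ l) :
    h x = l :=
  Set.singleton_injective (hc.eq_singleton l x hx)

/-- The prescribed sequence `σ i` can always be continued by a point of label `i` outside of it, if
there is one: where `w` does not do so, `σ i` fills a whole cycle, and another one can be
inserted. -/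
theorem labelledIdeal_eq_biUnion_appendPoint (hc : IsConsistent σ fun x => {h x})
    (hi : σ i = s ++ [a]) {τ : Finset (Fin n)} (hτ : (τ : Set (Fin n)) = outside σ h i)
    (hne : τ.Nonempty) :
    labelledIdeal σ (fun x => {h x}) =
      ⋃ b ∈ τ, labelledIdeal (appendPoint σ i b) (fun x => {h x}) := by
  have hmem : ∀ b, b ∈ τ ↔ h b = i ∧ b ∉ σ i := fun b => by
    rw [← Finset.mem_coe, hτ]; rfl
  have hha : h a = i := label_eq_of_mem hc (l := i) (by simp [hi])
  ext u
  simp only [Set.mem_iUnion, exists_prop]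
  constructor
  · rintro ⟨w, f, hu, hw⟩
    have hfh : ∀ x, f x = h x := hw.mem
    by_cases hwa : w a ∈ σ i
    · -- The points of `σ i` form a whole cycle of `w`.
      have hclosed : ∀ x ∈ {x | x ∈ σ i}, w x ∈ {x | x ∈ σ i} := by
        intro x hx
        obtain ⟨p, hp, rfl⟩ := List.getElem_of_mem (show x ∈ σ i from hx)
        by_cases hp1 : p + 1 < (σ i).length
        · have := List.isChain_iff_getElem.1 (hw.follows i) p hp1
          change w _ ∈ σ i
          rw [this]
          exact List.getElem_mem _
        · have : (σ i)[p] = a := by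
            have hlen : (σ i).length = s.length + 1 := by simp [hi]
            obtain rfl : p = s.length := by omega
            simp [hi]
          rw [this]; exact hwa
      obtain ⟨b, hb⟩ := hne
      obtain ⟨hb1, hb2⟩ := (hmem b).1 hb
      have hnot : ∀ x ∈ σ i, ¬ w.SameCycle x b := fun x hx hs =>
        hb2 (mem_of_sameCycle_of_forall hclosed hx hs)
      refine ⟨b, hb, mem_labelledIdeal_of_insert hu hw.apply_eq hw.mem (j := i) (s := s) (a := a)
        (b := b) (by rw [appendPoint_self, hi]) (hi ▸ hw.follows i) (hi ▸ hc.nodup i)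
        (hnot a (by simp [hi])) (by rw [hfh, hfh, hha, hb1]) fun l hl => ?_⟩
      rw [appendPoint_of_ne hl]
      refine ⟨hw.follows l, fun x hx => ⟨?_, fun hs => ?_⟩⟩
      · rintro rfl
        exact hl (by rw [← label_eq_of_mem hc hx, hha])
      · have := apply_eq_of_sameCycle hw.apply_eq hs
        rw [hfh, hfh, label_eq_of_mem hc hx, hb1] at this
        exact hl this
    · have hlab : h (w a) = i := by rw [← hfh, hw.apply_eq, hfh, hha]
      refine ⟨w a, (hmem _).2 ⟨hlab, hwa⟩, w, f, hu, fun l => ?_, hw.apply_eq, hw.mem⟩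
      by_cases hl : l = i
      · subst hl
        rw [appendPoint_self, hi, follows_concat_iff]
        exact ⟨hi ▸ hw.follows l, rfl⟩
      · rw [appendPoint_of_ne hl]; exact hw.follows l
  · rintro ⟨b, -, w, f, hu, hw⟩
    exact ⟨w, f, hu, Follows.of_appendPoint hw.follows, hw.apply_eq, hw.mem⟩

open Classical in
/-- The points of `T` get a new label of their own, which is also allowed for the other points
outside the sequence `σ i`. -/
def detachLabels (σ : ι → List (Fin n)) (h : Fin n → ι) (i : ι) (T : Set (Fin n)) (y : Fin n) :
    Set (Option ι) :=
  if y ∈ T then {none} else if y ∈ outside σ h i then {some i, none} else {some (h y)}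

open Classical in
/-- As `detachLabels`, except that `t` keeps the label `i`. -/
def detachLabelsExcept (σ : ι → List (Fin n)) (h : Fin n → ι) (i : ι) (T : Set (Fin n))
    (t y : Fin n) : Set (Option ι) :=
  if y = t then {some i} else detachLabels σ h i T y

open Classical in
/-- The points of `T` get two new labels: one for `t` and one for the other points. Both are also
allowed for the other points outside the sequence `σ i`. -/
def detachLabelsTwice (σ : ι → List (Fin n)) (h : Fin n → ι) (i : ι) (T : Set (Fin n))
    (t y : Fin n) : Set (Option (Option ι)) :=
  if y = t then {none} else if y ∈ T then {some none} else
    if y ∈ outside σ h i then {some (some i), some none, none} else {some (some (h y))}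

theorem detachLabels_of_mem {T : Set (Fin n)} {y : Fin n} (hy : y ∈ T) :
    detachLabels σ h i T y = {none} := if_pos hy

theorem detachLabels_of_outside {T : Set (Fin n)} {y : Fin n} (hy : y ∉ T)
    (ho : y ∈ outside σ h i) : detachLabels σ h i T y = {some i, none} := by
  rw [detachLabels, if_neg hy, if_pos ho]

theorem detachLabels_of_not_outside {T : Set (Fin n)} (hT : T ⊆ outside σ h i) {y : Fin n}
    (ho : y ∉ outside σ h i) : detachLabels σ h i T y = {some (h y)} := by
  rw [detachLabels, if_neg fun hy => ho (hT hy), if_neg ho]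

theorem not_outside_of_mem (hc : IsConsistent σ fun x => {h x}) {l : ι} {x : Fin n}
    (hx : x ∈ σ l) : x ∉ outside σ h i := by
  rintro ⟨h1, h2⟩
  rw [label_eq_of_mem hc hx] at h1
  subst h1
  exact h2 hx

/-- Every label is forced upon some point that is not outside the sequence `σ i`. -/
theorem exists_not_outside (hc : IsConsistent σ fun x => {h x}) (hi : σ i = s ++ [a]) (l : ι) :
    ∃ x, x ∉ outside σ h i ∧ h x = l := by
  by_cases hl : l = i
  · subst hl
    have ha : a ∈ σ l := by simp [hi]
    exact ⟨a, not_outside_of_mem hc ha, label_eq_of_mem hc ha⟩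
  · obtain ⟨x, hx⟩ := hc.exists_eq_singleton l
    have hx : h x = l := Set.singleton_injective hx
    exact ⟨x, fun ho => hl (by rw [← hx, ho.1]), hx⟩

theorem IsConsistent.detachLabels (hc : IsConsistent σ fun x => {h x}) (hi : σ i = s ++ [a])
    {T : Set (Fin n)} (hT : T ⊆ outside σ h i) (hne : T.Nonempty) :
    IsConsistent (addLabel σ) (detachLabels σ h i T) where
  nodup := by
    rintro (_ | l)
    · exact List.nodup_nil
    · exact hc.nodup l
  eq_singleton := by
    rintro o y hy
    obtain ⟨l, rfl, hyl⟩ := mem_addLabel hy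
    rw [detachLabels_of_not_outside hT (not_outside_of_mem hc hyl), label_eq_of_mem hc hyl]
  nonempty := by
    intro y
    rw [_root_.detachLabels]
    split_ifs <;> simp
  exists_eq_singleton := by
    rintro (_ | l)
    · obtain ⟨t, ht⟩ := hne
      exact ⟨t, detachLabels_of_mem ht⟩
    · obtain ⟨x, hx, rfl⟩ := exists_not_outside hc hi l
      exact ⟨x, detachLabels_of_not_outside hT hx⟩

theorem IsConsistent.detachLabelsExcept (hc : IsConsistent σ fun x => {h x}) (hi : σ i = s ++ [a])
    {T : Set (Fin n)} (hT : T ⊆ outside σ h i) {t t' : Fin n} (ht : t ∈ T) (ht' : t' ∈ T)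
    (htt : t' ≠ t) :
    IsConsistent (addLabel (_root_.appendPoint σ i t)) (detachLabelsExcept σ h i T t) where
  nodup := by
    rintro (_ | l)
    · exact List.nodup_nil
    · exact nodup_appendPoint hc.nodup (hT ht).2 l
  eq_singleton := by
    rintro o y hy
    obtain ⟨l, rfl, hyl⟩ := mem_addLabel hy
    rcases mem_appendPoint hyl with hyl | ⟨rfl, rfl⟩
    · have ho := not_outside_of_mem (i := i) hc hyl
      rw [_root_.detachLabelsExcept, if_neg (show y ≠ t from fun e => ho (hT (e ▸ ht))),
        detachLabels_of_not_outside hT ho, label_eq_of_mem hc hyl]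
    · rw [_root_.detachLabelsExcept, if_pos rfl]
  nonempty := by
    intro y
    rw [_root_.detachLabelsExcept, _root_.detachLabels]
    split_ifs <;> simp
  exists_eq_singleton := by
    rintro (_ | l)
    · exact ⟨t', by rw [_root_.detachLabelsExcept, if_neg htt, detachLabels_of_mem ht']⟩
    · obtain ⟨x, hx, rfl⟩ := exists_not_outside hc hi l
      exact ⟨x, by rw [_root_.detachLabelsExcept, if_neg (show x ≠ t from fun e => hx (hT (e ▸ ht))),
        detachLabels_of_not_outside hT hx]⟩

theorem detachLabelsTwice_of_not_outside {T : Set (Fin n)} (hT : T ⊆ outside σ h i) {t : Fin n}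
    (ht : t ∈ T) {y : Fin n} (ho : y ∉ outside σ h i) :
    detachLabelsTwice σ h i T t y = {some (some (h y))} := by
  rw [detachLabelsTwice, if_neg (show y ≠ t from fun e => ho (hT (e ▸ ht))), if_neg fun hy => ho (hT hy), if_neg ho]

theorem IsConsistent.detachLabelsTwice (hc : IsConsistent σ fun x => {h x}) (hi : σ i = s ++ [a])
    {T : Set (Fin n)} (hT : T ⊆ outside σ h i) {t t' : Fin n} (ht : t ∈ T) (ht' : t' ∈ T)
    (htt : t' ≠ t) :
    IsConsistent (addLabel (addLabel σ)) (detachLabelsTwice σ h i T t) where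
  nodup := by
    rintro (_ | _ | l)
    · exact List.nodup_nil
    · exact List.nodup_nil
    · exact hc.nodup l
  eq_singleton := by
    rintro o y hy
    obtain ⟨o, rfl, hyl⟩ := mem_addLabel hy
    obtain ⟨l, rfl, hyl⟩ := mem_addLabel hyl
    rw [detachLabelsTwice_of_not_outside hT ht (not_outside_of_mem hc hyl),
      label_eq_of_mem hc hyl]
  nonempty := by
    intro y
    rw [_root_.detachLabelsTwice]
    split_ifs <;> simp
  exists_eq_singleton := by
    rintro (_ | _ | l)
    · exact ⟨t, by rw [_root_.detachLabelsTwice, if_pos rfl]⟩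
    · exact ⟨t', by rw [_root_.detachLabelsTwice, if_neg htt, if_pos ht']⟩
    · obtain ⟨x, hx, rfl⟩ := exists_not_outside hc hi l
      exact ⟨x, detachLabelsTwice_of_not_outside hT ht hx⟩

end Extend

section Extend

variable {n : ℕ} {ι : Type*} {σ : ι → List (Fin n)} {h : Fin n → ι} {i : ι} {s : List (Fin n)}
  {a : Fin n}

/-- Fusing the new label with `i` turns a labelling with detached points into one for the original
constraints, and any detached point can be made to follow the sequence `σ i`. -/
theorem mem_labelledIdeal_appendPoint (hc : IsConsistent σ fun x => {h x}) (hi : σ i = s ++ [a])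
    {u w : Equiv.Perm (Fin n)} (hu : u ≤ w) (hw : ∀ l, Follows w (σ l)) {f : Fin n → Option ι}
    (hf : ∀ x, f (w x) = f x) (hfh : ∀ x, (f x).getD i = h x)
    (hfσ : ∀ l, ∀ x ∈ σ l, f x = some l) {b : Fin n} (hb : f b = none) :
    u ∈ labelledIdeal (appendPoint σ i b) fun x => {h x} := by
  have hai : a ∈ σ i := by simp [hi]
  have hnot : ∀ l, ∀ x ∈ σ l, ¬ w.SameCycle x b := by
    intro l x hx hs
    have := apply_eq_of_sameCycle hf hs
    rw [hfσ l x hx, hb] at this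
    exact Option.some_ne_none _ this
  refine mem_labelledIdeal_of_insert hu (f := fun x => (f x).getD i) (fun x => by rw [hf]) hfh
    (j := i) (s := s) (a := a) (b := b) (by rw [appendPoint_self, hi]) (hi ▸ hw i)
    (hi ▸ hc.nodup i) (hnot i a hai) (by simp [hb, hfσ i a hai]) fun l hl => ?_
  rw [appendPoint_of_ne hl]
  refine ⟨hw l, fun x hx => ⟨?_, hnot l x hx⟩⟩
  rintro rfl
  exact hl (by rw [← label_eq_of_mem hc hx, label_eq_of_mem hc hai])

theorem getD_eq_of_mem_detachLabels {T : Set (Fin n)} (hT : T ⊆ outside σ h i) {x : Fin n}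
    {o : Option ι} (ho : o ∈ detachLabels σ h i T x) : o.getD i = h x := by
  rw [detachLabels] at ho
  split_ifs at ho with h1 h2
  · rw [Set.mem_singleton_iff.1 ho]; exact (hT h1).1.symm
  · rcases ho with rfl | ho
    · exact h2.1.symm
    · rw [Set.mem_singleton_iff.1 ho]; exact h2.1.symm
  · rw [Set.mem_singleton_iff.1 ho]; rfl

theorem getD_eq_of_mem_detachLabelsExcept {T : Set (Fin n)} (hT : T ⊆ outside σ h i)
    {t x : Fin n} (ht : t ∈ T) {o : Option ι} (ho : o ∈ detachLabelsExcept σ h i T t x) :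
    o.getD i = h x := by
  rw [detachLabelsExcept] at ho
  split_ifs at ho with h1
  · rw [Set.mem_singleton_iff.1 ho, h1]; exact (hT ht).1.symm
  · exact getD_eq_of_mem_detachLabels hT ho

theorem eq_some_of_mem_detachLabels (hc : IsConsistent σ fun x => {h x}) {T : Set (Fin n)}
    (hT : T ⊆ outside σ h i) {l : ι} {x : Fin n} (hx : x ∈ σ l) {o : Option ι}
    (ho : o ∈ detachLabels σ h i T x) : o = some l := by
  rw [detachLabels_of_not_outside hT (not_outside_of_mem hc hx), label_eq_of_mem hc hx] at ho
  exact ho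

theorem eq_some_of_mem_detachLabelsExcept (hc : IsConsistent σ fun x => {h x}) {T : Set (Fin n)}
    (hT : T ⊆ outside σ h i) {l : ι} {t x : Fin n} (ht : t ∈ T) (hx : x ∈ σ l) {o : Option ι}
    (ho : o ∈ detachLabelsExcept σ h i T t x) : o = some l := by
  have hxt : x ≠ t := fun e => not_outside_of_mem (i := i) hc hx (hT (e ▸ ht))
  rw [detachLabelsExcept, if_neg hxt] at ho
  exact eq_some_of_mem_detachLabels hc hT hx ho

/-- If, for every `b ∈ T`, some permutation above `u` continues `σ i` by `b`, then at most one point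
`t ∈ T` shares a cycle of `u` with a point of `σ i`. The other points of `T` can be detached, and
the parts of the union correspond to the case without such a `t` and to the possible `t`. -/
theorem iInter_labelledIdeal_appendPoint (hc : IsConsistent σ fun x => {h x})
    (hi : σ i = s ++ [a]) {T : Finset (Fin n)} (hT : (T : Set (Fin n)) ⊆ outside σ h i)
    (hne : T.Nonempty) :
    ⋂ b ∈ T, labelledIdeal (appendPoint σ i b) (fun x => {h x}) =
      labelledIdeal (addLabel σ) (detachLabels σ h i T) ∪
        ⋃ t ∈ T, labelledIdeal (addLabel (appendPoint σ i t)) (detachLabelsExcept σ h i T t) := by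
  ext u
  simp only [Set.mem_iInter, Set.mem_union, Set.mem_iUnion, exists_prop]
  constructor
  · intro hu
    have huniq : ∀ t ∈ T, ∀ t' ∈ T, ∀ y ∈ σ i, ∀ y' ∈ σ i, u.SameCycle t y → u.SameCycle t' y' →
        t = t' := by
      intro t ht t' ht' y hy y' hy' hty hty'
      obtain ⟨w, f, hw, hlab⟩ := hu t ht
      obtain ⟨w', f', hw', hlab'⟩ := hu t' ht'
      have h1 := hlab.follows i
      have h2 := hlab'.follows i
      have n1 := nodup_appendPoint hc.nodup (hT ht).2 i
      have n2 := nodup_appendPoint hc.nodup (hT ht').2 i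
      rw [appendPoint_self] at h1 h2 n1 n2
      exact eq_of_follows_of_sameCycle hw hw' h1 h2 n1 n2 hy hy' hty hty'
    by_cases hX : ∃ t ∈ T, ∃ y ∈ σ i, u.SameCycle t y
    · right
      obtain ⟨t, ht, y, hy, hty⟩ := hX
      refine ⟨t, ht, ?_⟩
      obtain ⟨w, f, hw, hlab⟩ := hu t ht
      have hfh : ∀ x, f x = h x := hlab.mem
      have hblock : ∀ x ∈ cyclesMeeting u (T \ {t} : Set (Fin n)),
          h x = i ∧ x ∉ σ i ∧ x ≠ t := by
        rintro x ⟨t', ⟨ht', htt⟩, hx⟩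
        have e := apply_eq_of_sameCycle_of_le hw hlab.apply_eq hx
        rw [hfh, hfh, (hT ht').1] at e
        refine ⟨e.symm, fun hxi => ?_, ?_⟩
        · exact htt (huniq t' ht' t ht x hxi y hy hx hty)
        · rintro rfl
          exact htt (huniq t' ht' x ht y hy y hy (hx.trans hty) hty)
      refine mem_labelledIdeal_of_detach hw hlab.apply_eq (T \ {t} : Set (Fin n))
        (follows_addLabel.2 hlab.follows) ?_ some none ?_ ?_
      · intro o x hx hxD
        obtain ⟨l, rfl, hxl⟩ := mem_addLabel hx
        obtain ⟨h1, h2, h3⟩ := hblock x hxD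
        rcases mem_appendPoint hxl with hxl | ⟨-, hxt⟩
        · rw [label_eq_of_mem hc hxl] at h1
          exact h2 (h1 ▸ hxl)
        · exact h3 hxt
      · intro x hx
        obtain ⟨h1, h2, h3⟩ := hblock x hx
        rw [detachLabelsExcept, if_neg h3]
        by_cases hxT : x ∈ (T : Set (Fin n))
        · rw [detachLabels_of_mem hxT]; rfl
        · rw [detachLabels_of_outside hxT ⟨h1, h2⟩]; exact Or.inr rfl
      · intro x hx
        rw [hfh, detachLabelsExcept]
        split_ifs with hxt
        · rw [hxt, (hT ht).1]; rfl
        · have hxT : x ∉ (T : Set (Fin n)) := fun hxT => hx (mem_cyclesMeeting ⟨hxT, hxt⟩)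
          by_cases ho : x ∈ outside σ h i
          · rw [detachLabels_of_outside hxT ho, ho.1]; exact Or.inl rfl
          · rw [detachLabels_of_not_outside hT ho]; rfl
    · left
      push Not at hX
      obtain ⟨b, hb⟩ := hne
      obtain ⟨w, f, hw, hlab⟩ := hu b hb
      have hfh : ∀ x, f x = h x := hlab.mem
      have hblock : ∀ x ∈ cyclesMeeting u (T : Set (Fin n)), h x = i ∧ x ∉ σ i := by
        rintro x ⟨t', ht', hx⟩
        have e := apply_eq_of_sameCycle_of_le hw hlab.apply_eq hx
        rw [hfh, hfh, (hT ht').1] at e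
        exact ⟨e.symm, fun hxi => hX t' ht' x hxi hx⟩
      refine mem_labelledIdeal_of_detach hw hlab.apply_eq (T : Set (Fin n))
        (follows_addLabel.2 (Follows.of_appendPoint hlab.follows)) ?_ some none ?_ ?_
      · intro o x hx hxD
        obtain ⟨l, rfl, hxl⟩ := mem_addLabel hx
        obtain ⟨h1, h2⟩ := hblock x hxD
        rw [label_eq_of_mem hc hxl] at h1
        exact h2 (h1 ▸ hxl)
      · intro x hx
        by_cases hxT : x ∈ (T : Set (Fin n))
        · rw [detachLabels_of_mem hxT]; rfl
        · rw [detachLabels_of_outside hxT (hblock x hx)]; exact Or.inr rfl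
      · intro x hx
        have hxT : x ∉ (T : Set (Fin n)) := fun hxT => hx (mem_cyclesMeeting hxT)
        rw [hfh]
        by_cases ho : x ∈ outside σ h i
        · rw [detachLabels_of_outside hxT ho, ho.1]; exact Or.inl rfl
        · rw [detachLabels_of_not_outside hT ho]; rfl
  · rintro (⟨w, f, hw, hlab⟩ | ⟨t, ht, w, f, hw, hlab⟩) b hb
    · refine mem_labelledIdeal_appendPoint hc hi hw (follows_addLabel.1 hlab.follows) hlab.apply_eq
        (fun x => getD_eq_of_mem_detachLabels hT (hlab.mem x))
        (fun l x hx => eq_some_of_mem_detachLabels hc hT hx (hlab.mem x)) ?_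
      have := hlab.mem b
      rwa [detachLabels_of_mem (Finset.mem_coe.2 hb)] at this
    · have hget := fun x => getD_eq_of_mem_detachLabelsExcept hT ht (hlab.mem x)
      by_cases hbt : b = t
      · subst hbt
        exact ⟨w, fun x => (f x).getD i, hw, follows_addLabel.1 hlab.follows,
          fun x => by rw [hlab.apply_eq], hget⟩
      · refine mem_labelledIdeal_appendPoint hc hi hw
          (Follows.of_appendPoint (follows_addLabel.1 hlab.follows)) hlab.apply_eq hget
          (fun l x hx => eq_some_of_mem_detachLabelsExcept hc hT ht hx (hlab.mem x)) ?_
        have := hlab.mem b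
        rwa [detachLabelsExcept, if_neg hbt, detachLabels_of_mem (Finset.mem_coe.2 hb)] at this

theorem labelledIdeal_detachLabels_inter (hc : IsConsistent σ fun x => {h x})
    (hi : σ i = s ++ [a]) {T : Set (Fin n)} (hT : T ⊆ outside σ h i) {t : Fin n} (ht : t ∈ T) :
    labelledIdeal (addLabel σ) (detachLabels σ h i T) ∩
        labelledIdeal (addLabel (appendPoint σ i t)) (detachLabelsExcept σ h i T t) =
      labelledIdeal (addLabel (addLabel σ)) (detachLabelsTwice σ h i T t) := by
  have hai : a ∈ σ i := by simp [hi]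
  ext u
  constructor
  · rintro ⟨⟨w, f, hw, hlab⟩, ⟨w', f', hw', hlab'⟩⟩
    have hft : f t = none := by
      have := hlab.mem t
      rwa [detachLabels_of_mem ht] at this
    have hft' : f' t = some i := by
      have := hlab'.mem t
      rwa [detachLabelsExcept, if_pos rfl] at this
    have hblock : ∀ x ∈ cyclesMeeting u {t}, f x = none ∧ f' x = some i := by
      rintro x ⟨t', rfl, hx⟩
      exact ⟨by rw [← apply_eq_of_sameCycle_of_le hw hlab.apply_eq hx, hft],
        by rw [← apply_eq_of_sameCycle_of_le hw' hlab'.apply_eq hx, hft']⟩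
    refine mem_labelledIdeal_of_detach hw hlab.apply_eq {t} (follows_addLabel.2 hlab.follows)
      ?_ some none ?_ ?_
    · intro o x hx hxD
      obtain ⟨o, rfl, hxo⟩ := mem_addLabel hx
      obtain ⟨l, rfl, hxl⟩ := mem_addLabel hxo
      have := eq_some_of_mem_detachLabels hc hT hxl (hlab.mem x)
      rw [(hblock x hxD).1] at this
      exact Option.some_ne_none _ this.symm
    · intro x hx
      obtain ⟨h1, h2⟩ := hblock x hx
      rw [detachLabelsTwice]
      split_ifs with hxt hxT ho
      · rfl
      · have := hlab'.mem x
        rw [detachLabelsExcept, if_neg hxt, detachLabels_of_mem hxT, h2] at this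
        exact absurd this (Option.some_ne_none _)
      · exact Or.inr (Or.inr rfl)
      · have := hlab.mem x
        rw [detachLabels_of_not_outside hT ho, h1] at this
        exact absurd this.symm (Option.some_ne_none _)
    · intro x hx
      have hxt : x ≠ t := fun e => hx (mem_cyclesMeeting e)
      have := hlab.mem x
      rw [detachLabelsTwice, if_neg hxt]
      rw [detachLabels] at this
      split_ifs at this ⊢
      · rw [Set.mem_singleton_iff.1 this]; rfl
      · rcases this with h1 | h1
        · rw [h1]; exact Or.inl rfl
        · rw [Set.mem_singleton_iff.1 h1]; exact Or.inr (Or.inl rfl)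
      · rw [Set.mem_singleton_iff.1 this]; rfl
  · rintro ⟨w, f, hw, hlab⟩
    have hfol : ∀ l, Follows w (σ l) := follows_addLabel.1 (follows_addLabel.1 hlab.follows)
    have hft : f t = none := by
      have := hlab.mem t
      rwa [detachLabelsTwice, if_pos rfl] at this
    have hfσ : ∀ l, ∀ x ∈ σ l, f x = some (some l) := by
      intro l x hx
      have := hlab.mem x
      rwa [detachLabelsTwice_of_not_outside hT ht (not_outside_of_mem hc hx),
        label_eq_of_mem hc hx] at this
    have hnot : ∀ l, ∀ x ∈ σ l, ¬ w.SameCycle x t := by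
      intro l x hx hs
      have := apply_eq_of_sameCycle hlab.apply_eq hs
      rw [hfσ l x hx, hft] at this
      exact Option.some_ne_none _ this
    constructor
    · refine ⟨w, fun x => (f x).getD none, hw, follows_addLabel.2 hfol,
        fun x => by rw [hlab.apply_eq], fun x => ?_⟩
      have := hlab.mem x
      by_cases hxt : x = t
      · rw [hxt, hft, detachLabels_of_mem ht]; rfl
      · rw [detachLabelsTwice, if_neg hxt] at this
        rw [detachLabels]
        split_ifs at this ⊢
        · rw [Set.mem_singleton_iff.1 this]; rfl
        · rcases this with h1 | h1 | h1
          · rw [h1]; exact Or.inl rfl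
          · rw [h1]; exact Or.inr rfl
          · rw [Set.mem_singleton_iff.1 h1]; exact Or.inr rfl
        · rw [Set.mem_singleton_iff.1 this]; rfl
    · refine mem_labelledIdeal_of_insert hw (f := fun x => (f x).getD (some i))
        (fun x => by rw [hlab.apply_eq]) (fun x => ?_) (j := some i) (s := s) (a := a) (b := t)
        ((appendPoint_self t).trans (by rw [hi])) (hi ▸ hfol i) (hi ▸ hc.nodup i)
        (hnot i a hai) (by simp [hft, hfσ i a hai]) ?_
      · have := hlab.mem x
        by_cases hxt : x = t
        · rw [hxt, hft, detachLabelsExcept, if_pos rfl]; rfl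
        · rw [detachLabelsTwice, if_neg hxt] at this
          rw [detachLabelsExcept, if_neg hxt, detachLabels]
          split_ifs at this ⊢
          · rw [Set.mem_singleton_iff.1 this]; rfl
          · rcases this with h1 | h1 | h1
            · rw [h1]; exact Or.inl rfl
            · rw [h1]; exact Or.inr rfl
            · rw [Set.mem_singleton_iff.1 h1]; exact Or.inl rfl
          · rw [Set.mem_singleton_iff.1 this]; rfl
      · rintro (_ | l) hl
        · exact ⟨Follows.nil, fun x hx => by simp [addLabel] at hx⟩
        · have hli : l ≠ i := fun e => hl (by rw [e])
          change Follows w (appendPoint σ i t l) ∧ ∀ x ∈ appendPoint σ i t l, _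
          rw [appendPoint_of_ne hli]
          refine ⟨hfol l, fun x hx => ⟨?_, hnot l x hx⟩⟩
          rintro rfl
          exact hli (by rw [← label_eq_of_mem hc hx, label_eq_of_mem hc hai])

theorem labelledIdeal_detachLabelsExcept_inter_subset (hc : IsConsistent σ fun x => {h x})
    {T : Set (Fin n)} (hT : T ⊆ outside σ h i) {t t' : Fin n} (ht : t ∈ T) (ht' : t' ∈ T)
    (htt : t ≠ t') :
    labelledIdeal (addLabel (appendPoint σ i t)) (detachLabelsExcept σ h i T t) ∩
        labelledIdeal (addLabel (appendPoint σ i t')) (detachLabelsExcept σ h i T t') ⊆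
      labelledIdeal (addLabel σ) (detachLabels σ h i T) := by
  rintro u ⟨⟨w, f, hw, hlab⟩, ⟨w', f', hw', hlab'⟩⟩
  have hft : f' t = none := by
    have := hlab'.mem t
    rwa [detachLabelsExcept, if_neg htt, detachLabels_of_mem ht] at this
  have hblock : ∀ x ∈ cyclesMeeting u {t}, f' x = none := by
    rintro x ⟨t₁, rfl, hx⟩
    rw [← apply_eq_of_sameCycle_of_le hw' hlab'.apply_eq hx, hft]
  refine mem_labelledIdeal_of_detach hw hlab.apply_eq {t}
    (follows_addLabel.2 (Follows.of_appendPoint (follows_addLabel.1 hlab.follows))) ?_ id none ?_ ?_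
  · intro o x hx hxD
    obtain ⟨l, rfl, hxl⟩ := mem_addLabel hx
    have := eq_some_of_mem_detachLabelsExcept hc hT ht' hxl (hlab'.mem x)
    rw [hblock x hxD] at this
    exact Option.some_ne_none _ this.symm
  · intro x hx
    by_cases hxT : x ∈ T
    · rw [detachLabels_of_mem hxT]; rfl
    by_cases ho : x ∈ outside σ h i
    · rw [detachLabels_of_outside hxT ho]; exact Or.inr rfl
    · have := hlab'.mem x
      rw [detachLabelsExcept, if_neg (show x ≠ t' from fun e => hxT (e ▸ ht')),
        detachLabels_of_not_outside hT ho, hblock x hx] at this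
      exact absurd this.symm (Option.some_ne_none _)
  · intro x hx
    have hxt : x ≠ t := fun e => hx (mem_cyclesMeeting e)
    have := hlab.mem x
    rwa [detachLabelsExcept, if_neg hxt] at this

end Extend

/-! ### Labelled ideals with a single maximal element -/

section Base

variable {n : ℕ} {ι : Type*} {σ : ι → List (Fin n)} {h : Fin n → ι}

/-- A permutation that preserves the labels maps the last point of a sequence consisting of all
points of its label to the first one. -/
theorem IsLabelled.apply_getElem (hc : IsConsistent σ fun x => {h x})
    (hall : ∀ x, x ∈ σ (h x)) {w : Equiv.Perm (Fin n)} (hw : IsLabelled σ (fun x => {h x}) w h)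
    (l : ι) (p : ℕ) (hp : p < (σ l).length) :
    w (σ l)[p] = if hp1 : p + 1 < (σ l).length then (σ l)[p + 1] else (σ l)[0] := by
  have hchain := List.isChain_iff_getElem.1 (hw.follows l)
  split_ifs with hp1
  · exact hchain p hp1
  · have hlab : h (σ l)[p] = l := label_eq_of_mem hc (List.getElem_mem _)
    have hmem : w (σ l)[p] ∈ σ l := by
      have := hall (w (σ l)[p])
      rwa [hw.apply_eq, hlab] at this
    obtain ⟨q, hq, e⟩ := List.getElem_of_mem hmem
    rcases Nat.eq_zero_or_pos q with rfl | hq0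
    · exact e.symm
    · have h1 := hchain (q - 1) (by omega)
      simp only [Nat.sub_add_cancel hq0] at h1
      have h2 := w.injective (h1.trans e)
      have h3 := (List.Nodup.getElem_inj_iff (hc.nodup l)).1 h2
      omega

/-- If the sequences exhaust all points, the cycles given by the sequences form a labelled
permutation. -/
theorem exists_isLabelled (hc : IsConsistent σ fun x => {h x}) (hall : ∀ x, x ∈ σ (h x)) :
    ∃ w, IsLabelled σ (fun x => {h x}) w h := by
  let φ : Fin n → Fin n := fun x => (σ (h x)).formPerm x
  have hφ : ∀ x, h (φ x) = h x := fun x =>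
    label_eq_of_mem hc (List.formPerm_apply_mem_of_mem (hall x))
  have hinj : Function.Injective φ := by
    intro x y e
    have hxy : h x = h y := by rw [← hφ x, e, hφ y]
    have e' : (σ (h x)).formPerm x = (σ (h y)).formPerm y := e
    rw [hxy] at e'
    exact (σ (h y)).formPerm.injective e'
  refine ⟨Equiv.ofBijective φ (Finite.injective_iff_bijective.1 hinj), fun l => ?_, hφ,
    fun x => rfl⟩
  refine List.isChain_iff_getElem.2 fun p hp => ?_
  change (σ (h (σ l)[p])).formPerm (σ l)[p] = _
  rw [label_eq_of_mem hc (List.getElem_mem _), List.formPerm_apply_lt_getElem _ (hc.nodup l) _ hp]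

theorem labelledIdeal_eq_Iic (hc : IsConsistent σ fun x => {h x}) (hall : ∀ x, x ∈ σ (h x))
    {w : Equiv.Perm (Fin n)} (hw : IsLabelled σ (fun x => {h x}) w h) :
    labelledIdeal σ (fun x => {h x}) = Set.Iic w := by
  ext u
  constructor
  · rintro ⟨w', f, hu, hw'⟩
    obtain rfl : f = h := funext fun x => hw'.mem x
    have : w' = w := by
      ext1 x
      obtain ⟨p, hp, e⟩ := List.getElem_of_mem (hall x)
      rw [← e, hw'.apply_getElem hc hall, hw.apply_getElem hc hall]
    exact this ▸ hu
  · exact fun hu => ⟨w, h, hu, hw⟩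

theorem cycleCount_eq_card {κ : Type*} {w : Equiv.Perm (Fin n)} {f : Fin n → κ}
    (hf : ∀ x, f (w x) = f x) (hsurj : Function.Surjective f)
    (hinj : ∀ x y, f x = f y → w.SameCycle x y) : cycleCount w = Nat.card κ := by
  refine Nat.card_eq_of_bijective (Quotient.lift f fun x y hxy => apply_eq_of_sameCycle hf hxy)
    ⟨fun q q' => ?_, fun l => ?_⟩
  · induction q using Quotient.inductionOn with | _ x
    induction q' using Quotient.inductionOn with | _ y
    exact fun e => Quotient.sound (hinj x y e)
  · obtain ⟨x, rfl⟩ := hsurj l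
    exact ⟨Quotient.mk _ x, rfl⟩

theorem isConstructibleIdeal_of_forall_mem (hc : IsConsistent σ fun x => {h x})
    (hall : ∀ x, x ∈ σ (h x)) :
    IsConstructibleIdeal (labelledIdeal σ fun x => {h x}) ((n : ℤ) - Nat.card ι) := by
  obtain ⟨w, hw⟩ := exists_isLabelled hc hall
  rw [labelledIdeal_eq_Iic hc hall hw]
  have h1 : cycleCount w = Nat.card ι := cycleCount_eq_card hw.apply_eq
    (fun l => by
      obtain ⟨x, hx⟩ := hc.exists_eq_singleton l
      exact ⟨x, Set.singleton_injective hx⟩)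
    fun x y e => (hw.follows (h x)).sameCycle (hall x) (e ▸ hall y)
  have h2 := reflectionLength_add_cycleCount w
  refine ⟨isLowerSet_Iic w, isStronglyConstructible_Iic w, ?_⟩
  have h3 := hasRank_Iic w
  rwa [show (reflectionLength w : ℤ) = (n : ℤ) - Nat.card ι by omega] at h3

end Base

/-! ### Strong constructibility of labelled ideals -/

/-- The number of points without a forced label plus the number of points outside the prescribed
sequences. -/
noncomputable def freedom {n : ℕ} {ι : Type*} (σ : ι → List (Fin n)) (g : Fin n → Set ι) : ℕ :=
  {x | ¬ (g x).Subsingleton}.ncard + {x | ∀ l, x ∉ σ l}.ncard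

section Recursion

variable {n : ℕ} {ι : Type} {σ : ι → List (Fin n)} {g : Fin n → Set ι}

theorem freedom_update_lt {x : Fin n} (hx : ¬ (g x).Subsingleton) (i : ι) :
    freedom σ (Function.update g x {i}) < freedom σ g := by
  have hss : {y | ¬ (Function.update g x {i} y).Subsingleton} ⊂ {y | ¬ (g y).Subsingleton} := by
    refine ⟨fun y hy hs => hy ?_, fun hsub => hsub (show x ∈ _ from hx) (by simp)⟩
    by_cases hyx : y = x
    · subst hyx; simp
    · rwa [Function.update_of_ne hyx]
  exact Nat.add_lt_add_right (Set.ncard_lt_ncard hss (Set.toFinite _)) _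

theorem freedom_appendPoint_lt {i : ι} {b : Fin n} (hb : ∀ l, b ∉ σ l) :
    freedom (appendPoint σ i b) g < freedom σ g := by
  have hss : {y | ∀ l, y ∉ appendPoint σ i b l} ⊂ {y | ∀ l, y ∉ σ l} := by
    refine ⟨fun y hy l hyl => hy l ?_, fun hsub => hsub (show b ∈ _ from hb) i ?_⟩
    swap
    · rw [appendPoint_self]; simp
    by_cases hl : l = i
    · subst hl; rw [appendPoint_self]; exact List.mem_append_left _ hyl
    · rwa [appendPoint_of_ne hl]
  exact Nat.add_lt_add_left (Set.ncard_lt_ncard hss (Set.toFinite _)) _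

/-- A point with several allowed labels is resolved by choosing one of them. -/
theorem isConstructibleIdeal_of_not_subsingleton [Finite ι] (hc : IsConsistent σ g) {x : Fin n}
    (hx : ¬ (g x).Subsingleton)
    (hlabel : ∀ i, IsConstructibleIdeal (labelledIdeal σ (Function.update g x {i}))
      ((n : ℤ) - Nat.card ι))
    (hrec : ∀ (σ' : Option ι → List (Fin n)) (g' : Fin n → Set (Option ι)), IsConsistent σ' g' →
      IsConstructibleIdeal (labelledIdeal σ' g') ((n : ℤ) - Nat.card ι - 1)) :
    IsConstructibleIdeal (labelledIdeal σ g) ((n : ℤ) - Nat.card ι) := by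
  classical
  have hs : ((Set.toFinite (g x)).toFinset : Set ι) = g x := Set.Finite.coe_toFinset _
  rw [labelledIdeal_eq_biUnion_update hs]
  refine IsConstructibleIdeal.biUnion _ _ ?_ (fun i _ => hlabel i) fun T hT hT2 => ?_
  · obtain ⟨l, hl⟩ := hc.nonempty x
    exact ⟨l, (Set.Finite.mem_toFinset _).2 hl⟩
  · have hnt : (T : Set ι).Nontrivial :=
      Finset.one_lt_card_iff_nontrivial.1 (by omega : 1 < T.card)
    rw [iInter_labelledIdeal_update hc.eq_singleton hnt (hs ▸ Finset.coe_subset.2 hT)]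
    exact hrec _ _ (hc.splitLabels hnt hx)

/-- An empty prescribed sequence can be replaced by a single point that must have its label. -/
theorem labelledIdeal_appendPoint_of_nil {i : ι} (hi : σ i = []) (b : Fin n) :
    labelledIdeal (appendPoint σ i b) g = labelledIdeal σ g := by
  ext u
  constructor
  · rintro ⟨w, f, h, hw⟩
    exact ⟨w, f, h, Follows.of_appendPoint hw.follows, hw.apply_eq, hw.mem⟩
  · rintro ⟨w, f, h, hw⟩
    refine ⟨w, f, h, fun l => ?_, hw.apply_eq, hw.mem⟩
    by_cases hl : l = i
    · subst hl
      rw [appendPoint_self, hi]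
      exact Follows.singleton b
    · rw [appendPoint_of_ne hl]; exact hw.follows l

/-- If all labels are forced, a sequence that does not yet exhaust its label is prolonged by one of
the remaining points. -/
theorem isConstructibleIdeal_of_outside [Finite ι] {h : Fin n → ι}
    (hc : IsConsistent σ fun x => {h x}) {i : ι} {s : List (Fin n)} {a : Fin n}
    (hi : σ i = s ++ [a]) (hne : (outside σ h i).Nonempty)
    (happend : ∀ b ∈ outside σ h i,
      IsConstructibleIdeal (labelledIdeal (appendPoint σ i b) fun x => {h x})
        ((n : ℤ) - Nat.card ι))
    (hrec : ∀ (σ' : Option ι → List (Fin n)) (g' : Fin n → Set (Option ι)), IsConsistent σ' g' →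
      IsConstructibleIdeal (labelledIdeal σ' g') ((n : ℤ) - Nat.card ι - 1))
    (hrec' : ∀ (σ' : Option (Option ι) → List (Fin n)) (g' : Fin n → Set (Option (Option ι))),
      IsConsistent σ' g' →
      IsConstructibleIdeal (labelledIdeal σ' g') ((n : ℤ) - Nat.card ι - 1 - 1)) :
    IsConstructibleIdeal (labelledIdeal σ fun x => {h x}) ((n : ℤ) - Nat.card ι) := by
  classical
  have hτ : ((Set.toFinite (outside σ h i)).toFinset : Set (Fin n)) = outside σ h i :=
    Set.Finite.coe_toFinset _
  have hmem : ∀ b, b ∈ (Set.toFinite (outside σ h i)).toFinset ↔ b ∈ outside σ h i :=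
    fun b => Set.Finite.mem_toFinset _
  obtain ⟨b, hb⟩ := hne
  rw [labelledIdeal_eq_biUnion_appendPoint hc hi hτ ⟨b, (hmem b).2 hb⟩]
  refine IsConstructibleIdeal.biUnion _ _ ⟨b, (hmem b).2 hb⟩
    (fun b hb => happend b ((hmem b).1 hb)) fun T hT hT2 => ?_
  have hTo : (T : Set (Fin n)) ⊆ outside σ h i := fun t ht => (hmem t).1 (hT ht)
  have hTne : T.Nonempty := Finset.card_pos.1 (by omega)
  have hother : ∀ t ∈ T, ∃ t' ∈ T, t' ≠ t := fun t ht =>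
    (Finset.one_lt_card_iff_nontrivial.1 (by omega : 1 < T.card)).exists_ne t
  rw [iInter_labelledIdeal_appendPoint hc hi hTo hTne]
  refine IsConstructibleIdeal.union_biUnion _ _ _ (hrec _ _ (hc.detachLabels hi hTo hTne))
    (fun t ht => ?_) (fun t ht => ?_) fun t ht t' ht' htt =>
      labelledIdeal_detachLabelsExcept_inter_subset hc hTo ht ht' htt
  · obtain ⟨t', ht', htt⟩ := hother t ht
    exact hrec _ _ (hc.detachLabelsExcept hi hTo ht ht' htt)
  · obtain ⟨t', ht', htt⟩ := hother t ht
    rw [labelledIdeal_detachLabels_inter hc hi hTo ht]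
    exact hrec' _ _ (hc.detachLabelsTwice hi hTo ht ht' htt)

end Recursion

/-- Consistent constraints define a strongly constructible ideal whose rank is the length of
a permutation with exactly one cycle for each label. -/
theorem isConstructibleIdeal_labelledIdeal {n : ℕ} {ι : Type} [Finite ι]
    {σ : ι → List (Fin n)} {g : Fin n → Set ι} (hc : IsConsistent σ g) :
    IsConstructibleIdeal (labelledIdeal σ g) ((n : ℤ) - Nat.card ι) := by
  induction hm : n - Nat.card ι using Nat.strong_induction_on generalizing ι with
  | _ m ihm =>
  induction hk : freedom σ g using Nat.strong_induction_on generalizing σ g with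
  | _ k ihk =>
  have hrec : ∀ (σ' : Option ι → List (Fin n)) (g' : Fin n → Set (Option ι)),
      IsConsistent σ' g' →
      IsConstructibleIdeal (labelledIdeal σ' g') ((n : ℤ) - Nat.card ι - 1) := by
    intro σ' g' hc'
    have h1 := hc'.card_le
    have h2 : Nat.card (Option ι) = Nat.card ι + 1 := Finite.card_option
    have := ihm _ (by omega) hc' rfl
    rwa [h2, Nat.cast_add, Nat.cast_one, ← sub_sub] at this
  have hrec' : ∀ (σ' : Option (Option ι) → List (Fin n)) (g' : Fin n → Set (Option (Option ι))),
      IsConsistent σ' g' →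
      IsConstructibleIdeal (labelledIdeal σ' g') ((n : ℤ) - Nat.card ι - 1 - 1) := by
    intro σ' g' hc'
    have h1 := hc'.card_le
    have h2 : Nat.card (Option (Option ι)) = Nat.card ι + 1 + 1 := by
      rw [Finite.card_option, Finite.card_option]
    have := ihm _ (by omega) hc' rfl
    rwa [h2, Nat.cast_add, Nat.cast_add, Nat.cast_one, ← sub_sub, ← sub_sub] at this
  by_cases hsub : ∃ x, ¬ (g x).Subsingleton
  · obtain ⟨x, hx⟩ := hsub
    exact isConstructibleIdeal_of_not_subsingleton hc hx
      (fun i => ihk _ (hk ▸ freedom_update_lt hx i) (hc.update_label hx i) rfl) hrec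
  push Not at hsub
  obtain ⟨h, rfl⟩ : ∃ h : Fin n → ι, g = fun x => {h x} := by
    choose h hh using hc.nonempty
    exact ⟨h, funext fun x => (hsub x).eq_singleton_of_mem (hh x)⟩
  by_cases hnil : ∃ i, σ i = []
  · obtain ⟨i, hi⟩ := hnil
    obtain ⟨b, hb⟩ := hc.exists_eq_singleton i
    have hbσ : ∀ l, b ∉ σ l := by
      intro l hbl
      have h1 := label_eq_of_mem hc hbl
      rw [Set.singleton_injective hb] at h1
      rw [← h1, hi] at hbl
      exact List.not_mem_nil hbl
    rw [← labelledIdeal_appendPoint_of_nil hi b]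
    exact ihk _ (hk ▸ freedom_appendPoint_lt hbσ) (hc.appendPoint (hbσ i) hb) rfl
  by_cases hout : ∃ i, (outside σ h i).Nonempty
  · obtain ⟨i, hne⟩ := hout
    obtain ⟨s, a, hi⟩ := (List.eq_nil_or_concat' (σ i)).resolve_left fun e => hnil ⟨i, e⟩
    refine isConstructibleIdeal_of_outside hc hi hne (fun b hb => ?_) hrec hrec'
    have hbσ : ∀ l, b ∉ σ l := fun l hbl => not_outside_of_mem hc hbl hb
    exact ihk _ (hk ▸ freedom_appendPoint_lt hbσ) (hc.appendPoint (hbσ i) (by rw [hb.1])) rfl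
  · refine isConstructibleIdeal_of_forall_mem hc fun x => ?_
    by_contra hx
    exact hout ⟨h x, x, rfl, hx⟩

/-! ### The ideals generated by the sets `S_n(R)` -/

section CycleDatum

variable {n k : ℕ} (R : CycleDatum n k)

/-- The prescribed sequences for `S_n(R)`: only the label `0` has a nonempty one. -/
def CycleDatum.sequence (l : Fin (k + 1)) : List (Fin n) := if l = 0 then R.σ else []

/-- The labels allowed by `S_n(R)`. -/
def CycleDatum.labels (x : Fin n) : Set (Fin (k + 1)) :=
  {i | (x ∈ R.σ → i = 0) ∧ ∀ j, x ∈ R.τ j → i = j}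

variable {R}

theorem CycleDatum.mem_sequence {l : Fin (k + 1)} {x : Fin n} (hx : x ∈ R.sequence l) :
    l = 0 ∧ x ∈ R.σ := by
  rw [CycleDatum.sequence] at hx
  split_ifs at hx with h
  · exact ⟨h, hx⟩
  · exact absurd hx List.not_mem_nil

theorem CycleDatum.labels_of_mem_σ {x : Fin n} (hx : x ∈ R.σ) : R.labels x = {0} := by
  ext i
  exact ⟨fun h => h.1 hx, fun h => ⟨fun _ => h, fun j hj => absurd hj (R.σ_notMem_τ x hx j)⟩⟩

theorem CycleDatum.labels_of_mem_τ {x : Fin n} {j : Fin (k + 1)} (hx : x ∈ R.τ j) :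
    R.labels x = {j} := by
  ext i
  refine ⟨fun h => h.2 j hx, fun h => ⟨fun hσ => absurd hx (R.σ_notMem_τ x hσ j), ?_⟩⟩
  intro j' hj'
  by_contra hne
  rw [Set.mem_singleton_iff.1 h] at hne
  exact Finset.disjoint_left.1 (R.τ_disjoint j j' hne) hx hj'

theorem CycleDatum.isConsistent : IsConsistent R.sequence R.labels where
  nodup l := by
    rw [CycleDatum.sequence]
    split_ifs
    · exact R.σ_nodup
    · exact List.nodup_nil
  eq_singleton l x hx := by
    obtain ⟨rfl, hx⟩ := CycleDatum.mem_sequence hx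
    exact CycleDatum.labels_of_mem_σ hx
  nonempty x := by
    by_cases hx : x ∈ R.σ
    · exact ⟨0, by rw [CycleDatum.labels_of_mem_σ hx]; rfl⟩
    by_cases hj : ∃ j, x ∈ R.τ j
    · obtain ⟨j, hj⟩ := hj
      exact ⟨j, by rw [CycleDatum.labels_of_mem_τ hj]; rfl⟩
    · exact ⟨0, fun h => absurd h hx, fun j h => absurd ⟨j, h⟩ hj⟩
  exists_eq_singleton l := by
    by_cases hl : l = 0
    · obtain ⟨x, hx⟩ := List.exists_mem_of_ne_nil _ R.σ_ne_nil
      exact ⟨x, hl ▸ CycleDatum.labels_of_mem_σ hx⟩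
    · obtain ⟨x, hx⟩ := R.τ_nonempty l hl
      exact ⟨x, CycleDatum.labels_of_mem_τ hx⟩

open Equiv in
/-- A labelled permutation that is as long as possible has a single cycle for each label: two cycles
with the same label could be merged, at the end of `σ` if one of them contains `σ`. -/
theorem sameCycle_of_label_eq {w : Perm (Fin n)} {f : Fin n → Fin (k + 1)}
    (hw : IsLabelled R.sequence R.labels w f)
    (hmax : ∀ w', w ≤ w' → IsLabelled R.sequence R.labels w' f →
      reflectionLength w' ≤ reflectionLength w) {x y : Fin n} (hxy : f x = f y) :
    w.SameCycle x y := by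
  by_contra hnot
  obtain ⟨s, a, hs⟩ := (List.eq_nil_or_concat' R.σ).resolve_left R.σ_ne_nil
  have hfol : Follows w R.σ := hw.follows 0
  have hnd := R.σ_nodup
  have hstep : ∀ x, ∃ x', w.SameCycle x x' ∧ (x' ∈ R.σ → x' = a) := by
    intro x
    by_cases hx : x ∈ R.σ
    · exact ⟨a, hfol.sameCycle hx (by simp [hs]), fun _ => rfl⟩
    · exact ⟨x, Perm.SameCycle.refl _ _, fun h => absurd h hx⟩
  obtain ⟨x', hx, hxa⟩ := hstep x
  obtain ⟨y', hy, hya⟩ := hstep y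
  have hnot' : ¬ w.SameCycle x' y' := fun h => hnot ((hx.trans h).trans hy.symm)
  have hf : f x' = f y' := by
    rw [← apply_eq_of_sameCycle hw.apply_eq hx, hxy, apply_eq_of_sameCycle hw.apply_eq hy]
  have hlab : IsLabelled R.sequence R.labels (w * swap x' y') f := by
    refine ⟨fun l => ?_, fun z => ?_, hw.mem⟩
    · rw [CycleDatum.sequence]
      split_ifs
      · rw [hs] at hfol hnd ⊢
        refine hfol.congr_of_dropLast fun z hz => ?_
        have hza : z ≠ a := fun e => (List.nodup_append.1 hnd).2.2 z hz a (by simp) e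
        have hzσ : z ∈ R.σ := by simp [hs, hz]
        rw [Perm.mul_apply, swap_apply_of_ne_of_ne]
        · rintro rfl; exact hza (hxa hzσ)
        · rintro rfl; exact hza (hya hzσ)
      · exact Follows.nil
    · rw [Perm.mul_apply, hw.apply_eq]
      by_cases hzx : z = x'
      · rw [hzx, swap_apply_left, hf]
      by_cases hzy : z = y'
      · rw [hzy, swap_apply_right, hf]
      · rw [swap_apply_of_ne_of_ne hzx hzy]
  have h1 := hmax _ (absolute_le_mul_swap hnot') hlab
  have h2 := reflectionLength_mul_swap hnot'
  omega

theorem lowerClosure_perms :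
    (lowerClosure R.perms : Set (Equiv.Perm (Fin n))) = labelledIdeal R.sequence R.labels := by
  ext u
  constructor
  · rintro ⟨w, ⟨c, hσ, hchain, hτ⟩, hu⟩
    refine ⟨w, fun x => c.symm (Quotient.mk _ x), hu, fun l => ?_, fun x => ?_, fun x => ⟨?_, ?_⟩⟩
    · rw [CycleDatum.sequence]
      split_ifs
      · exact hchain
      · exact Follows.nil
    · exact congrArg c.symm (Quotient.sound (Equiv.Perm.SameCycle.symm ⟨1, by simp⟩))
    · intro hx; rw [hσ x hx, Equiv.symm_apply_apply]
    · intro j hx; rw [hτ j x hx, Equiv.symm_apply_apply]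
  · rintro ⟨w₀, f, hu, hw₀⟩
    obtain ⟨w, ⟨hw₀w, hw⟩, hmax⟩ := (Set.toFinite
      {w | w₀ ≤ w ∧ IsLabelled R.sequence R.labels w f}).exists_maximalFor reflectionLength _
      ⟨w₀, le_rfl, hw₀⟩
    have hcyc : ∀ x y, f x = f y → w.SameCycle x y := fun x y => sameCycle_of_label_eq hw
      fun w' hww' hw' => by
        rcases le_total (reflectionLength w') (reflectionLength w) with h | h
        · exact h
        · exact hmax ⟨hw₀w.trans hww', hw'⟩ h
    let F : Quotient (Equiv.Perm.SameCycle.setoid w) → Fin (k + 1) :=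
      Quotient.lift f fun x y hxy => apply_eq_of_sameCycle hw.apply_eq hxy
    have hF : Function.Bijective F := by
      constructor
      · intro q q'
        induction q using Quotient.inductionOn with | _ x
        induction q' using Quotient.inductionOn with | _ y
        exact fun e => Quotient.sound (hcyc x y e)
      · intro l
        obtain ⟨x, hx⟩ := (CycleDatum.isConsistent (R := R)).exists_eq_singleton l
        have := hw.mem x
        rw [hx] at this
        exact ⟨Quotient.mk _ x, this⟩
    let c := (Equiv.ofBijective F hF).symm
    have hc : ∀ x, Quotient.mk (Equiv.Perm.SameCycle.setoid w) x = c (f x) := fun x =>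
      ((Equiv.ofBijective F hF).symm_apply_apply _).symm
    refine ⟨w, ⟨c, fun x hx => ?_, hw.follows 0, fun i x hx => ?_⟩, hu.trans hw₀w⟩
    · rw [hc, (hw.mem x).1 hx]
    · rw [hc, (hw.mem x).2 i hx]

end CycleDatum

theorem isStronglyConstructible_lowerClosure_perms {n k : ℕ} (R : CycleDatum n k) :
    IsStronglyConstructible (lowerClosure R.perms : Set (Equiv.Perm (Fin n))) := by
  rw [lowerClosure_perms]
  exact (isConstructibleIdeal_labelledIdeal CycleDatum.isConsistent).isStronglyConstructible

theorem proposition4p2 (n : ℕ) (hn : 1 ≤ n) :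
    (∀ (k : ℕ) (R : CycleDatum n k),
      IsStronglyConstructible (lowerClosure R.perms : Set (Equiv.Perm (Fin n)))) ∧
    IsStronglyConstructible (Set.univ : Set (Equiv.Perm (Fin n))) := by
  refine ⟨fun k R => isStronglyConstructible_lowerClosure_perms R, ?_⟩
  -- For `k = 0`, `τ 0 = ∅` and a sequence with a single entry there is no constraint at all.
  let R : CycleDatum n 0 :=
    { σ := [⟨0, hn⟩]
      τ := fun _ => ∅
      σ_ne_nil := by simp
      σ_nodup := by simp
      τ_disjoint := fun _ _ _ => Finset.disjoint_empty_left _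
      τ_nonempty := fun i hi => absurd (Fin.ext (by omega)) hi
      σ_notMem_τ := fun _ _ _ => Finset.notMem_empty _ }
  have huniv : (Set.univ : Set (Equiv.Perm (Fin n))) = lowerClosure R.perms := by
    rw [lowerClosure_perms]
    have hall : ∀ u, u ∈ labelledIdeal R.sequence R.labels := by
      refine fun u => ⟨u, fun _ => 0, le_rfl, fun l => ?_, fun _ => rfl,
        fun x => ⟨fun _ => rfl, fun j _ => Fin.ext (by omega)⟩⟩
      rw [CycleDatum.sequence, if_pos (Fin.ext (by omega))]
      exact Follows.singleton _
    exact (Set.eq_univ_of_forall hall).symm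
  rw [huniv]
  exact isStronglyConstructible_lowerClosure_perms R
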